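/- Let $d\ge 1$, let $\mathcal X\subset\mathbb R^d$ carry the Euclidean distance and the Borel $\sigma$-algebra, let $f:\mathcal X\to\mathcal X$ be measurable, and let $\nu$ be an $f$-invariant ergodic Borel probability measure on $\mathcal X$ that is absolutely continuous with respect to Lebesgue measure on $\mathbb R^d$. Fix $\tilde x\in\mathcal X$ and write $B(\tilde x,r)=\{y\in\mathcal X:\operatorname{dist}(y,\tilde x)\le r\}$. Assume the following. (i) $\nu(B(\tilde x,r))>0$ for all $r>0$, and the local dimension $d_\nu=\lim_{r\to0}\frac{\log\nu(B(\tilde x,r))}{\log r}$ exists as a real number. (ii) There are $\delta>0$, $C$ and $r_0>0$ such that $|\nu(B(\tilde x,r+\epsilon))-\nu(B(\tilde x,r))|\le C\epsilon^\delta$ for all $0<\epsilon<r<r_0$. (iii) There are $C'$ and $r_1>0$ such that $\nu(B(\tilde x,2r))\le C'\nu(B(\tilde x,r))$ for all $0<r<r_1$. (This holds for instance whenever $\nu$ has a density $\rho(\tilde x)=\lim_{r\to 0}\nu(B(\tilde x,r))/\mathrm{Leb}\{y\in\mathbb R^d:|y-\tilde x|\le r\}\in(0,\infty)$ at $\tilde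 x$, hence for $\nu$-a.e. $\tilde x$.) (iv) There is a decreasing sequence $\Theta(j)\to0$ such that for all bounded Lipschitz $\varphi_1,\varphi_2:\mathcal X\to\mathbb R$ and all $j\ge0$, $$\Big|\int\varphi_1\cdot\varphi_2\circ f^j\,d\nu-\int\varphi_1\,d\nu\int\varphi_2\,d\nu\Big|\le\Theta(j)\,\|\varphi_1\|_{\mathrm{Lip}}\|\varphi_2\|_{\mathrm{Lip}},$$ where $\|\varphi\|_{\mathrm{Lip}}=\sup|\varphi|+\mathrm{Lip}(\varphi)$. (v) One of the following two cases holds. In both, an $\epsilon_1$-test sequence is a sequence of radii $r_n>0$ with $\sum_n\nu(B(\tilde x,r_n))=\infty$ and $\nu(B(\tilde x,r_n))=O(n^{-1+\epsilon_1})$; write $B_n=B(\tilde x,r_n)$. Case 1: $\Theta(n)=O(\theta_0^n)$ for some $\theta_0\in(0,1)$, and there is $\epsilon_1>0$ such that for every $\epsilon_1$-test sequence there exist $a>0$ and $\gamma>1$ such that, for all sufficiently large $n$, $\nu(B_n\cap f^{-k}B_n)\le\nu(B_n)^{1+a}$ for all integers $1\le k\le(\log n)^\gamma$. Case 2: $\Theta(n)=O(n^{-\zeta})$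 for some $\zeta>1$, and there is $\epsilon_1>0$ such that for every $\epsilon_1$-test sequence there exist $a,\gamma>\frac{2\delta^{-1}+1}{\zeta-1}$ such that, for all sufficiently large $n$, $\nu(B_n\cap f^{-k}B_n)\le\nu(B_n)^{1+a}$ for all integers $1\le k\le n^\gamma$. Let $\alpha>0$, $\phi(x)=\operatorname{dist}(x,\tilde x)^{-\alpha}$ and $M_n(x)=\max_{0\le i<n}\phi(f^i(x))$. Then for every non-decreasing real sequence $u_n\to\infty$, $$\nu\Big(\limsup_{n\to\infty}\frac{M_n(x)}{u_n}=0\Big)=1\qquad\text{or}\qquad\nu\Big(\limsup_{n\to\infty}\frac{M_n(x)}{u_n}=\infty\Big)=1 .$$ -/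

import Mathlib

open MeasureTheory Filter Topology Asymptotics

/-- `(f, ν)` has decay of correlations for Lipschitz observables with rate function `Θ`:
`Θ` decreases to `0` and
`|∫ φ₁ · φ₂ ∘ f^j dν - ∫ φ₁ dν ∫ φ₂ dν| ≤ Θ(j) ‖φ₁‖_Lip ‖φ₂‖_Lip`,
where `‖φ‖_Lip` is the supremum of `|φ|` plus the least Lipschitz constant of `φ`
(below, `b` runs over the bounds of `|φ|` and `K` over the Lipschitz constants). -/
def LipDecay {X : Type*} [MetricSpace X] [MeasurableSpace X]
    (f : X → X) (ν : Measure X) (Θ : ℕ → ℝ) : Prop :=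
  Antitone Θ ∧ Tendsto Θ atTop (𝓝 0) ∧
    ∀ (φ₁ φ₂ : X → ℝ) (b₁ b₂ : ℝ) (K₁ K₂ : NNReal),
      (∀ x, |φ₁ x| ≤ b₁) → LipschitzWith K₁ φ₁ →
      (∀ x, |φ₂ x| ≤ b₂) → LipschitzWith K₂ φ₂ →
      ∀ j : ℕ, |∫ x, φ₁ x * φ₂ (f^[j] x) ∂ν - (∫ x, φ₁ x ∂ν) * ∫ x, φ₂ x ∂ν| ≤
        Θ j * (b₁ + K₁) * (b₂ + K₂)

/-- The local dimension of `ν` exists at `x` and equals `D`. Balls have positive measure, so that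
the logarithm in the quotient is meaningful. -/
def HasLocalDim {X : Type*} [MetricSpace X] [MeasurableSpace X]
    (ν : Measure X) (x : X) (D : ℝ) : Prop :=
  (∀ r : ℝ, 0 < r → 0 < ν.real (Metric.closedBall x r)) ∧
    Tendsto (fun r : ℝ => Real.log (ν.real (Metric.closedBall x r)) / Real.log r)
      (𝓝[>] 0) (𝓝 D)

/-- Regularity of `ν` on shrinking annuli about `x`, with Hölder exponent `δ`. -/
def AnnulusRegular {X : Type*} [MetricSpace X] [MeasurableSpace X]
    (ν : Measure X) (x : X) (δ : ℝ) : Prop :=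
  ∃ C r₀ : ℝ, 0 < r₀ ∧ ∀ ε r : ℝ, 0 < ε → ε < r → r < r₀ →
    |ν.real (Metric.closedBall x (r + ε)) - ν.real (Metric.closedBall x r)| ≤ C * ε ^ δ

/-- Comparability of the measures of concentric small balls about `x`. -/
def DoublingAt {X : Type*} [MetricSpace X] [MeasurableSpace X]
    (ν : Measure X) (x : X) : Prop :=
  ∃ C r₁ : ℝ, 0 < r₁ ∧ ∀ r : ℝ, 0 < r → r < r₁ →
    ν.real (Metric.closedBall x (2 * r)) ≤ C * ν.real (Metric.closedBall x r)

/-- Lack of short returns to `x`, with exponent `a` and time horizon `g`, along the balls of radii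
`r n`: for all large `n`,
`ν(B(x, r n) ∩ f^{-k} B(x, r n)) ≤ ν(B(x, r n))^{1 + a}` whenever `1 ≤ k ≤ g n`. -/
def FewReturns {X : Type*} [MetricSpace X] [MeasurableSpace X]
    (f : X → X) (ν : Measure X) (x : X) (r : ℕ → ℝ) (a : ℝ) (g : ℕ → ℝ) : Prop :=
  ∀ᶠ n in atTop, ∀ k : ℕ, 1 ≤ k → (k : ℝ) ≤ g n →
    ν.real (Metric.closedBall x (r n) ∩ f^[k] ⁻¹' Metric.closedBall x (r n)) ≤
      ν.real (Metric.closedBall x (r n)) ^ (1 + a)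

/-- The sequences of balls about `x` to which the short return condition applies: the measures are
not summable and are `O(n^{-1+ε})`. -/
def TestRadii {X : Type*} [MetricSpace X] [MeasurableSpace X]
    (ν : Measure X) (x : X) (ε : ℝ) (r : ℕ → ℝ) : Prop :=
  (∀ n, 0 < r n) ∧
    ¬ Summable (fun n => ν.real (Metric.closedBall x (r n))) ∧
    (fun n => ν.real (Metric.closedBall x (r n))) =O[atTop] fun n : ℕ => (n : ℝ) ^ (-1 + ε)

/-- Lack of short returns to `x` up to polynomial times `n^γ`, where both the exponent `a` and `γ`
exceed `s`. -/
def NoShortReturnsPoly {X : Type*} [MetricSpace X] [MeasurableSpace X]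
    (f : X → X) (ν : Measure X) (x : X) (s : ℝ) : Prop :=
  ∃ ε : ℝ, 0 < ε ∧ ∀ r : ℕ → ℝ, TestRadii ν x ε r →
    ∃ a γ : ℝ, s < a ∧ s < γ ∧ FewReturns f ν x r a (fun n => (n : ℝ) ^ γ)

/-- Lack of short returns to `x` up to times `(log n)^γ` for some `γ > 1`. -/
def NoShortReturnsLog {X : Type*} [MetricSpace X] [MeasurableSpace X]
    (f : X → X) (ν : Measure X) (x : X) : Prop :=
  ∃ ε : ℝ, 0 < ε ∧ ∀ r : ℕ → ℝ, TestRadii ν x ε r →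
    ∃ a γ : ℝ, 0 < a ∧ 1 < γ ∧ FewReturns f ν x r a (fun n => Real.log n ^ γ)

/-- The maximum process `M_n = max (φ, φ ∘ f, …, φ ∘ f^{n-1})` (and `M_0 = 0`). -/
noncomputable def maxProcess {X : Type*} (f : X → X) (φ : X → ℝ) (n : ℕ) (x : X) : ℝ :=
  ⨆ i : Fin n, φ (f^[(i : ℕ)] x)

/-! The orbit satisfies `φ (f^[n] x) ≥ c u_{n+1}` exactly when it hits the ball of radius `c^(-1/α)
ρ n`, `ρ n = u_{n+1}^(-1/α)`, up to the value at `p` itself. Everything is thus decided by the sum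
of `ν (B(p, ρ n))`; by doubling (`DoublingAt.summable_mul`) its convergence is unaffected by
rescaling the radii. If it converges, the first Borel–Cantelli lemma keeps the orbit outside every
multiple of the balls eventually, and the limsup is `0`. If it diverges, the orbit must enter every
multiple infinitely often, and the limsup is infinite.

The second half is a dynamical Borel–Cantelli lemma (`ae_frequently_mem_closedBall_of_mixing`),
proved by a second moment estimate on the number of hits. Pairs of hits at a short time gap are
controlled by the short return hypothesis; pairs at a long gap by decay of correlations, applied to
Lipschitz cutoffs whose width is a power of the measure of the ball. Two reductions make this work:
capping the measures at `1 / (n + 2)` keeps the sum divergent and yields a test sequence, and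
dropping indices of measure below `(n + 1)^(-(1 + κ))` keeps the Lipschitz norms polynomial in `n`.
-/

/-! ### Second moment Borel–Cantelli lemma -/

/-- If `T` is arbitrarily large and `a (T - K)² ≤ η T² + C (T + 1)` for every `η > 0` with
`C = C(η)`, then `a ≤ 0`. -/
theorem nonpos_of_mul_sq_le {a K : ℝ} {T : ℕ → ℝ} (hT : Tendsto T atTop atTop)
    (h : ∀ η : ℝ, 0 < η → ∃ C : ℝ, ∀ N, K ≤ T N →
      a * (T N - K) ^ 2 ≤ η * T N ^ 2 + C * (T N + 1)) : a ≤ 0 := by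
  by_contra! ha
  -- For `T ≥ 2|K|` the left side is at least `aT²/4`; `η = a/8` absorbs half of it, and the rest
  -- `aT²/8 ≤ 2|C|T` fails once `T > 16|C|/a`.
  obtain ⟨C, hC⟩ := h (a / 8) (by positivity)
  obtain ⟨N, hN⟩ := ((hT.eventually_ge_atTop (2 * |K|)).and ((hT.eventually_ge_atTop 1).and
    (hT.eventually_gt_atTop (16 * |C| / a)))).exists
  obtain ⟨h1, h2, h3⟩ := hN
  have hK := le_abs_self K
  have hK' := abs_nonneg K
  have h4 := hC N (by linarith)
  have h5 : a * (T N / 2) ^ 2 ≤ a * (T N - K) ^ 2 := by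
    gcongr
    linarith
  have h6 : C * (T N + 1) ≤ |C| * (2 * T N) := by
    have : C * (T N + 1) ≤ |C| * (T N + 1) := by gcongr; exact le_abs_self C
    have : |C| * (T N + 1) ≤ |C| * (2 * T N) := by gcongr; linarith
    linarith
  rw [div_lt_iff₀ ha] at h3
  nlinarith [mul_lt_mul_of_pos_right h3 (by linarith : 0 < T N)]

theorem integral_sum_indicator_mul_sum_indicator {Ω : Type*} [MeasurableSpace Ω] (μ : Measure Ω)
    [IsProbabilityMeasure μ] {E : ℕ → Set Ω} (hE : ∀ n, MeasurableSet (E n)) (N : ℕ) :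
    ∫ x, (∑ i ∈ Finset.range N, (E i).indicator (fun _ => (1 : ℝ)) x) ^ 2 ∂μ =
      ∑ i ∈ Finset.range N, ∑ j ∈ Finset.range N, μ.real (E i ∩ E j) := by
  have hI : ∀ i j : ℕ, (fun x => (E i).indicator (fun _ => (1 : ℝ)) x *
      (E j).indicator (fun _ => (1 : ℝ)) x) = (E i ∩ E j).indicator (fun _ => (1 : ℝ)) := by
    intro i j
    ext x
    by_cases h1 : x ∈ E i <;> by_cases h2 : x ∈ E j <;> simp [h1, h2]
  have hint : ∀ i j : ℕ, Integrable (fun x => (E i).indicator (fun _ => (1 : ℝ)) x *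
      (E j).indicator (fun _ => (1 : ℝ)) x) μ := by
    intro i j
    rw [hI]
    exact (integrable_const 1).indicator ((hE i).inter (hE j))
  simp only [sq, Finset.sum_mul_sum]
  rw [integral_finsetSum _ fun i _ => integrable_finsetSum _ fun j _ => hint i j]
  refine Finset.sum_congr rfl fun i _ => ?_
  rw [integral_finsetSum _ fun j _ => hint i j]
  refine Finset.sum_congr rfl fun j _ => ?_
  rw [hI, integral_indicator_const _ ((hE i).inter (hE j))]
  simp

theorem integrable_sum_indicator_sub_sq {Ω : Type*} [MeasurableSpace Ω] (μ : Measure Ω)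
    [IsProbabilityMeasure μ] {E : ℕ → Set Ω} (hE : ∀ n, MeasurableSet (E n)) (N : ℕ) (c : ℝ) :
    Integrable (fun x =>
      (∑ i ∈ Finset.range N, (E i).indicator (fun _ => (1 : ℝ)) x - c) ^ 2) μ := by
  have hm : Measurable fun x => ∑ i ∈ Finset.range N, (E i).indicator (fun _ => (1 : ℝ)) x :=
    Finset.measurable_sum _ fun i _ => measurable_const.indicator (hE i)
  refine Integrable.of_bound ((hm.sub_const c).pow_const 2).aestronglyMeasurable
    (((N : ℝ) + |c|) ^ 2) (Eventually.of_forall fun x => ?_)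
  rw [norm_pow, Real.norm_eq_abs]
  refine pow_le_pow_left₀ (abs_nonneg _) ((abs_sub _ _).trans (add_le_add ?_ le_rfl)) 2
  calc _ ≤ ∑ i ∈ Finset.range N, |(E i).indicator (fun _ => (1 : ℝ)) x| :=
        Finset.abs_sum_le_sum_abs _ _
    _ ≤ ∑ i ∈ Finset.range N, (1 : ℝ) := by
        refine Finset.sum_le_sum fun i _ => ?_
        by_cases hx : x ∈ E i <;> simp [hx]
    _ = N := by simp

theorem integral_sum_indicator_sub_sq {Ω : Type*} [MeasurableSpace Ω] (μ : Measure Ω)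
    [IsProbabilityMeasure μ] {E : ℕ → Set Ω} (hE : ∀ n, MeasurableSet (E n)) (N : ℕ) (c : ℝ) :
    ∫ x, (∑ i ∈ Finset.range N, (E i).indicator (fun _ => (1 : ℝ)) x - c) ^ 2 ∂μ =
      ∑ i ∈ Finset.range N, ∑ j ∈ Finset.range N, μ.real (E i ∩ E j) -
        2 * c * ∑ i ∈ Finset.range N, μ.real (E i) + c ^ 2 := by
  have hint : ∀ i, Integrable ((E i).indicator (fun _ => (1 : ℝ))) μ := fun i =>
    (integrable_const 1).indicator (hE i)
  have hsum : Integrable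
      (fun x => ∑ i ∈ Finset.range N, (E i).indicator (fun _ => (1 : ℝ)) x) μ :=
    integrable_finsetSum _ fun i _ => hint i
  have hsq : Integrable
      (fun x => (∑ i ∈ Finset.range N, (E i).indicator (fun _ => (1 : ℝ)) x) ^ 2) μ := by
    simpa using integrable_sum_indicator_sub_sq μ hE N 0
  have e : ∀ y : ℝ, (y - c) ^ 2 = y ^ 2 - 2 * c * y + c ^ 2 := fun y => by ring
  simp only [e]
  rw [integral_add, integral_sub hsq (hsum.const_mul _), integral_const_mul,
    integral_sum_indicator_mul_sum_indicator μ hE N, integral_finsetSum _ fun i _ => hint i]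
  · simp [integral_indicator_const, hE]
  · exact hsq.sub (hsum.const_mul _)
  · exact integrable_const _

theorem sq_sum_measureReal_le {Ω : Type*} [MeasurableSpace Ω] (μ : Measure Ω)
    [IsProbabilityMeasure μ] {E : ℕ → Set Ω} (hE : ∀ n, MeasurableSet (E n)) (N : ℕ) :
    (∑ i ∈ Finset.range N, μ.real (E i)) ^ 2 ≤
      ∑ i ∈ Finset.range N, ∑ j ∈ Finset.range N, μ.real (E i ∩ E j) := by
  have h := integral_sum_indicator_sub_sq μ hE N (∑ i ∈ Finset.range N, μ.real (E i))
  have h' : 0 ≤ ∫ x, (∑ i ∈ Finset.range N, (E i).indicator (fun _ => (1 : ℝ)) x -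
      ∑ i ∈ Finset.range N, μ.real (E i)) ^ 2 ∂μ := integral_nonneg fun _ => sq_nonneg _
  rw [h] at h'
  linarith

/-- **Second moment Borel–Cantelli lemma**. -/
theorem ae_frequently_mem_of_secondMoment {Ω : Type*} [MeasurableSpace Ω] (μ : Measure Ω)
    [IsProbabilityMeasure μ] {E : ℕ → Set Ω} (hE : ∀ n, MeasurableSet (E n))
    (hdiv : ¬ Summable fun n => μ.real (E n))
    (h : ∀ η : ℝ, 0 < η → ∃ C : ℝ, ∀ N : ℕ,
      ∑ i ∈ Finset.range N, ∑ j ∈ Finset.range N, μ.real (E i ∩ E j) ≤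
        (1 + η) * (∑ i ∈ Finset.range N, μ.real (E i)) ^ 2 +
          C * (∑ i ∈ Finset.range N, μ.real (E i) + 1)) :
    ∀ᵐ x ∂μ, ∃ᶠ n in atTop, x ∈ E n := by
  set S : ℕ → Ω → ℝ := fun N x => ∑ i ∈ Finset.range N, (E i).indicator (fun _ => (1 : ℝ)) x
    with hS
  set T : ℕ → ℝ := fun N => ∑ i ∈ Finset.range N, μ.real (E i) with hT
  have hTlim : Tendsto T atTop atTop :=
    (not_summable_iff_tendsto_nat_atTop_of_nonneg fun _ => measureReal_nonneg).1 hdiv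
  have hSm : ∀ N, Measurable (S N) := fun N =>
    Finset.measurable_sum _ fun i _ => measurable_const.indicator (hE i)
  have hvar : ∀ N, ∫ x, (S N x - T N) ^ 2 ∂μ =
      ∑ i ∈ Finset.range N, ∑ j ∈ Finset.range N, μ.real (E i ∩ E j) - T N ^ 2 := fun N => by
    have h1 := integral_sum_indicator_sub_sq μ hE N (T N)
    have h2 : ∑ i ∈ Finset.range N, μ.real (E i) = T N := rfl
    rw [h2] at h1
    refine h1.trans ?_
    ring
  -- Chebyshev: where all `S N ≤ K`, the deviation `(S N - T N)²` is at least `(T N - K)²` once `T N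
  -- ≥ K`, while its integral is `η T² + O(T + 1)` with `η` arbitrary.
  have hA : ∀ K : ℕ, μ {x | ∀ N, S N x ≤ K} = 0 := by
    intro K
    have hAm : MeasurableSet {x | ∀ N, S N x ≤ K} := by
      rw [Set.ofPred_forall]
      exact MeasurableSet.iInter fun N => measurableSet_le (hSm N) measurable_const
    have : μ.real {x | ∀ N, S N x ≤ K} ≤ 0 := by
      refine nonpos_of_mul_sq_le (K := K) hTlim fun η hη => ?_
      obtain ⟨C, hC⟩ := h η hη
      refine ⟨C, fun N hN => ?_⟩
      have h1 : ∫ x, ({x | ∀ N, S N x ≤ K}).indicator (fun _ => (T N - K) ^ 2) x ∂μ ≤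
          ∫ x, (S N x - T N) ^ 2 ∂μ := by
        refine integral_mono ((integrable_const _).indicator hAm) (integrable_sum_indicator_sub_sq μ hE N (T N)) fun x => ?_
        by_cases hx : x ∈ {x | ∀ N, S N x ≤ K}
        · rw [Set.indicator_of_mem hx]
          have := hx N
          nlinarith
        · rw [Set.indicator_of_notMem hx]
          positivity
      rw [integral_indicator_const _ hAm, hvar, smul_eq_mul] at h1
      have := hC N
      have h2 : ∑ i ∈ Finset.range N, μ.real (E i) = T N := rfl
      rw [h2] at this
      linarith
    exact (measureReal_eq_zero_iff).1 (le_antisymm this measureReal_nonneg)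
  have hA' : ∀ᵐ x ∂μ, ∀ K : ℕ, ¬ ∀ N, S N x ≤ K := by
    rw [ae_all_iff]
    intro K
    rw [ae_iff]
    simpa using hA K
  filter_upwards [hA'] with x hx
  by_contra hnf
  rw [not_frequently, eventually_atTop] at hnf
  obtain ⟨K, hK⟩ := hnf
  refine hx K fun N => ?_
  calc S N x ≤ ∑ i ∈ Finset.range N, if i < K then (1 : ℝ) else 0 := by
        refine Finset.sum_le_sum fun i _ => ?_
        split_ifs with hi
        · exact Set.indicator_le_self' (fun _ _ => zero_le_one) x
        · rw [Set.indicator_of_notMem (hK i (not_lt.1 hi))]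
    _ = ((Finset.range N).filter (· < K)).card := by simp
    _ ≤ (Finset.range K).card := by
        norm_cast
        refine Finset.card_le_card fun i hi => ?_
        simpa using (Finset.mem_filter.1 hi).2
    _ = K := by simp

/-- Second moment Borel–Cantelli lemma with bounds on the pairs `i < j`. -/
theorem ae_frequently_mem_of_pair_bound {Ω : Type*} [MeasurableSpace Ω] (μ : Measure Ω)
    [IsProbabilityMeasure μ] {E : ℕ → Set Ω} (hE : ∀ n, MeasurableSet (E n))
    (hdiv : ¬ Summable fun n => μ.real (E n))
    (h : ∀ η : ℝ, 0 < η → ∃ (b : ℕ → ℕ → ℝ) (C : ℝ),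
      (∀ i j, i < j → μ.real (E i ∩ E j) ≤ (1 + η) * (μ.real (E i) * μ.real (E j)) + b i j) ∧
      ∀ N : ℕ, ∑ i ∈ Finset.range N, ∑ j ∈ Finset.range N, (if i < j then b i j else 0) ≤
        C * (∑ i ∈ Finset.range N, μ.real (E i) + 1)) :
    ∀ᵐ x ∂μ, ∃ᶠ n in atTop, x ∈ E n := by
  refine ae_frequently_mem_of_secondMoment μ hE hdiv fun η hη => ?_
  obtain ⟨b, C, hb, hC⟩ := h η hη
  -- The diagonal contributes `1`; each error `b i j` occurs for both orders of the pair.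
  refine ⟨1 + 2 * C, fun N => ?_⟩
  have key : ∀ i j, μ.real (E i ∩ E j) ≤ (1 + η) * (μ.real (E i) * μ.real (E j)) +
      ((if i < j then b i j else 0) + (if j < i then b j i else 0) +
        (if i = j then μ.real (E i) else 0)) := by
    intro i j
    rcases lt_trichotomy i j with hij | hij | hij
    · simpa [hij, hij.not_gt, hij.ne] using hb i j hij
    · subst hij
      simp only [Set.inter_self, lt_irrefl, if_false, if_true]
      have : 0 ≤ (1 + η) * (μ.real (E i) * μ.real (E i)) := by positivity
      linarith
    · have := hb j i hij
      rw [Set.inter_comm, mul_comm (μ.real (E j))] at this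
      simpa [hij, hij.not_gt, hij.ne'] using this
  have hsw : ∑ i ∈ Finset.range N, ∑ j ∈ Finset.range N, (if j < i then b j i else 0) =
      ∑ i ∈ Finset.range N, ∑ j ∈ Finset.range N, (if i < j then b i j else 0) :=
    Finset.sum_comm
  have hdg : ∑ i ∈ Finset.range N, ∑ j ∈ Finset.range N, (if i = j then μ.real (E i) else 0) =
      ∑ i ∈ Finset.range N, μ.real (E i) := by
    refine Finset.sum_congr rfl fun i hi => ?_
    rw [Finset.sum_ite_eq, if_pos hi]
  calc _ ≤ _ := Finset.sum_le_sum fun i _ => Finset.sum_le_sum fun j _ => key i j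
    _ = (1 + η) * (∑ i ∈ Finset.range N, μ.real (E i)) ^ 2 +
        (2 * ∑ i ∈ Finset.range N, ∑ j ∈ Finset.range N, (if i < j then b i j else 0) +
          ∑ i ∈ Finset.range N, μ.real (E i)) := by
        simp only [Finset.sum_add_distrib, ← Finset.mul_sum]
        rw [hsw, hdg, sq, Finset.sum_mul]
        ring
    _ ≤ _ := by
        have := hC N
        linarith

/-! ### Sums over pairs of indices -/

theorem sum_ite_le_card {g w : ℝ} (hw : 0 ≤ w) (hg : 0 ≤ g) (i N : ℕ) :
    ∑ j ∈ Finset.range N, (if i < j ∧ ((j - i : ℕ) : ℝ) ≤ g then w else 0) ≤ g * w := by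
  rw [← Finset.sum_filter, Finset.sum_const, nsmul_eq_mul]
  gcongr
  calc _ ≤ ((Finset.Ioc i (i + ⌊g⌋₊)).card : ℝ) := by
        norm_cast
        refine Finset.card_le_card fun j hj => ?_
        simp only [Finset.mem_filter, Finset.mem_Ioc] at hj ⊢
        have := Nat.le_floor hj.2.2
        omega
    _ ≤ g := by simpa using Nat.floor_le hg

/-- With one index fixed the differences `j - i` are distinct, so the inner sum is at most the total
of `q`. Weights at both ends are allowed because exponential decay gives a bound at the earlier
index and polynomial decay at the later one. -/
theorem sum_sum_mul_sub_le {p q : ℕ → ℝ} (hp : Summable p) (hq : Summable q)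
    (hp0 : ∀ n, 0 ≤ p n) (hq0 : ∀ n, 0 ≤ q n) (N : ℕ) :
    ∑ i ∈ Finset.range N, ∑ j ∈ Finset.range N, (if i < j then (p i + p j) * q (j - i) else 0) ≤
      2 * ((∑' n, p n) * ∑' n, q n) := by
  have hq1 : ∀ i, ∑ j ∈ Finset.range N, (if i < j then q (j - i) else 0) ≤ ∑' n, q n := by
    intro i
    rw [← Finset.sum_filter]
    rw [← Finset.sum_image (s := (Finset.range N).filter (i < ·)) (g := fun j => j - i)
      (f := fun k => q k)]
    · exact hq.sum_le_tsum _ fun n _ => hq0 n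
    · intro a ha b hb hab
      simp at ha hb hab
      omega
  have hq2 : ∀ j, ∑ i ∈ Finset.range N, (if i < j then q (j - i) else 0) ≤ ∑' n, q n := by
    intro j
    rw [← Finset.sum_filter]
    rw [← Finset.sum_image (s := (Finset.range N).filter (· < j)) (g := fun i => j - i)
      (f := fun k => q k)]
    · exact hq.sum_le_tsum _ fun n _ => hq0 n
    · intro a ha b hb hab
      simp at ha hb hab
      omega
  have hQ : 0 ≤ ∑' n, q n := tsum_nonneg hq0
  have e : ∀ i j, (if i < j then (p i + p j) * q (j - i) else 0) =
      p i * (if i < j then q (j - i) else 0) + p j * (if i < j then q (j - i) else 0) := by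
    intro i j
    split_ifs <;> ring
  simp only [e, Finset.sum_add_distrib]
  have h1 : ∑ i ∈ Finset.range N, ∑ j ∈ Finset.range N, p i * (if i < j then q (j - i) else 0) ≤
      (∑' n, p n) * ∑' n, q n := by
    calc _ ≤ ∑ i ∈ Finset.range N, p i * ∑' n, q n := by
          refine Finset.sum_le_sum fun i _ => ?_
          rw [← Finset.mul_sum]
          exact mul_le_mul_of_nonneg_left (hq1 i) (hp0 i)
      _ ≤ _ := by
          rw [← Finset.sum_mul]
          exact mul_le_mul_of_nonneg_right (hp.sum_le_tsum _ fun n _ => hp0 n) hQ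
  have h2 : ∑ i ∈ Finset.range N, ∑ j ∈ Finset.range N, p j * (if i < j then q (j - i) else 0) ≤
      (∑' n, p n) * ∑' n, q n := by
    rw [Finset.sum_comm]
    calc _ ≤ ∑ i ∈ Finset.range N, p i * ∑' n, q n := by
          refine Finset.sum_le_sum fun i _ => ?_
          rw [← Finset.mul_sum]
          exact mul_le_mul_of_nonneg_left (hq2 i) (hp0 i)
      _ ≤ _ := by
          rw [← Finset.sum_mul]
          exact mul_le_mul_of_nonneg_right (hp.sum_le_tsum _ fun n _ => hp0 n) hQ
  linarith

/-! ### Lipschitz cutoffs and correlations of balls -/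

theorem LipDecay.nonneg {X : Type*} [MetricSpace X] [MeasurableSpace X] {f : X → X}
    {ν : Measure X} {Θ : ℕ → ℝ} (h : LipDecay f ν Θ) (j : ℕ) : 0 ≤ Θ j :=
  h.1.le_of_tendsto h.2.1 j

theorem measureReal_closedBall_mono {X : Type*} [MetricSpace X] [MeasurableSpace X] (ν : Measure X) [IsProbabilityMeasure ν] (p : X) {r s : ℝ}
    (h : r ≤ s) : ν.real (Metric.closedBall p r) ≤ ν.real (Metric.closedBall p s) :=
  measureReal_mono (Metric.closedBall_subset_closedBall h)

section Cutoff

variable {X : Type*} [MetricSpace X]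

/-- The Lipschitz cutoff which is `1` on `closedBall p r` and `0` off `closedBall p (r + ε)`. -/
noncomputable def ballCutoff (p : X) (r ε : ℝ) (x : X) : ℝ :=
  max 0 (min 1 (1 + (r - dist x p) * ε⁻¹))

theorem lipschitzWith_ballCutoff (p : X) (r : ℝ) {ε : ℝ} (hε : 0 < ε) :
    LipschitzWith (NNReal.mk ε⁻¹ (inv_pos.2 hε).le) (ballCutoff p r ε) := by
  refine LipschitzWith.const_max (LipschitzWith.const_min ?_ 1) 0
  refine LipschitzWith.of_dist_le_mul fun x y => ?_
  rw [Real.dist_eq, NNReal.coe_mk,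
    show 1 + (r - dist x p) * ε⁻¹ - (1 + (r - dist y p) * ε⁻¹) =
      ε⁻¹ * (dist y p - dist x p) by ring, abs_mul, abs_of_pos (inv_pos.2 hε)]
  gcongr
  rw [dist_comm x y]
  exact abs_dist_sub_le y x p

theorem ballCutoff_nonneg (p : X) (r ε : ℝ) (x : X) : 0 ≤ ballCutoff p r ε x := le_max_left _ _

theorem ballCutoff_le_one (p : X) (r ε : ℝ) (x : X) : ballCutoff p r ε x ≤ 1 :=
  max_le zero_le_one (min_le_left _ _)

theorem ballCutoff_eq_one {p : X} {r ε : ℝ} (hε : 0 < ε) {x : X}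
    (hx : x ∈ Metric.closedBall p r) : ballCutoff p r ε x = 1 := by
  have : 0 ≤ (r - dist x p) * ε⁻¹ :=
    mul_nonneg (sub_nonneg.2 hx) (inv_pos.2 hε).le
  rw [ballCutoff, min_eq_left (by linarith), max_eq_right zero_le_one]

theorem ballCutoff_eq_zero {p : X} {r ε : ℝ} (hε : 0 < ε) {x : X}
    (hx : x ∉ Metric.closedBall p (r + ε)) : ballCutoff p r ε x = 0 := by
  rw [Metric.mem_closedBall, not_le] at hx
  have : (r - dist x p) * ε⁻¹ ≤ -1 := by
    rw [← div_eq_mul_inv, div_le_iff₀ hε]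
    linarith
  rw [ballCutoff, max_eq_left]
  exact (min_le_right _ _).trans (by linarith)

end Cutoff

section Balls

variable {X : Type*} [MetricSpace X] [MeasurableSpace X] [BorelSpace X]

/-- Off the null sphere of radius `r`, the indicators of nearby balls converge pointwise; dominated
convergence applies. -/
theorem continuous_measureReal_closedBall (ν : Measure X) [IsProbabilityMeasure ν] {p : X}
    (h : ∀ t, ν (Metric.sphere p t) = 0) :
    Continuous fun r : ℝ => ν.real (Metric.closedBall p r) := by
  have e : (fun r : ℝ => ν.real (Metric.closedBall p r)) =
      fun r => ∫ x, (Metric.closedBall p r).indicator (fun _ => (1 : ℝ)) x ∂ν := by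
    ext r
    rw [integral_indicator_const _ Metric.isClosed_closedBall.measurableSet]
    simp
  rw [e, continuous_iff_continuousAt]
  intro r
  refine continuousAt_of_dominated (bound := fun _ => 1) ?_ ?_ (integrable_const _) ?_
  · exact Eventually.of_forall fun s => (measurable_const.indicator
      Metric.isClosed_closedBall.measurableSet).aestronglyMeasurable
  · refine Eventually.of_forall fun s => Eventually.of_forall fun x => ?_
    by_cases hx : x ∈ Metric.closedBall p s <;> simp [hx]
  · filter_upwards [measure_eq_zero_iff_ae_notMem.1 (h r)] with x hx
    rcases lt_or_gt_of_ne (show dist x p ≠ r from hx) with h1 | h1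
    · refine continuousAt_const.congr (f := fun _ => (1 : ℝ)) ?_
      filter_upwards [lt_mem_nhds h1] with s hs
      rw [Set.indicator_of_mem]
      exact hs.le
    · refine continuousAt_const.congr (f := fun _ => (0 : ℝ)) ?_
      filter_upwards [gt_mem_nhds h1] with s hs
      rw [Set.indicator_of_notMem]
      simpa using hs

theorem exists_measureReal_closedBall_eq (ν : Measure X) [IsProbabilityMeasure ν] {p : X}
    (h : ∀ t, ν (Metric.sphere p t) = 0) {t : ℝ} (ht : 0 < t) (ht' : t < 1) :
    ∃ s : ℝ, 0 < s ∧ ν.real (Metric.closedBall p s) = t := by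
  have h0 : ν.real (Metric.closedBall p 0) = 0 := by
    have := h 0
    rw [Metric.sphere_zero] at this
    simp [Measure.real, this]
  have hlim : Tendsto (fun n : ℕ => ν.real (Metric.closedBall p n)) atTop (𝓝 1) := by
    have h1 := tendsto_measure_iUnion_atTop (μ := ν) (s := fun n : ℕ => Metric.closedBall p (n : ℝ))
      fun a b hab => Metric.closedBall_subset_closedBall (by exact_mod_cast hab)
    rw [Metric.iUnion_closedBall_nat, measure_univ] at h1
    exact (ENNReal.tendsto_toReal ENNReal.one_ne_top).comp h1
  obtain ⟨n, hn⟩ := (hlim.eventually (lt_mem_nhds ht')).exists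
  obtain ⟨s, hs⟩ := mem_range_of_exists_le_of_exists_ge
    (continuous_measureReal_closedBall ν h) ⟨0, h0.le.trans ht.le⟩ ⟨n, hn.le⟩
  refine ⟨s, ?_, hs⟩
  by_contra! hs0
  have := measureReal_closedBall_mono ν p hs0
  simp only at hs
  linarith

/-- Cut the ball into annuli between radii `r` and `2r/3`, whose thickness `r/3` is below the inner
radius as regularity demands. Their measures sum as a geometric series of ratio `(2/3)^δ`, and the
remainder tends to `ν {p} = 0`. -/
theorem AnnulusRegular.exists_measureReal_closedBall_le {ν : Measure X} [IsProbabilityMeasure ν]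
    {p : X} {δ : ℝ} (hδ : 0 < δ) (h : ∀ t, ν (Metric.sphere p t) = 0)
    (hann : AnnulusRegular ν p δ) :
    ∃ C r₁ : ℝ, 0 < C ∧ 0 < r₁ ∧ ∀ r, 0 < r → r < r₁ →
      ν.real (Metric.closedBall p r) ≤ C * r ^ δ := by
  obtain ⟨C₀, r₀, hr₀, hC₀⟩ := hann
  set ρ : ℝ := (2 / 3) ^ δ
  have hρ : ρ < 1 := Real.rpow_lt_one (by norm_num) (by norm_num) hδ
  have hρ0 : 0 < 1 - ρ := by linarith
  -- Chosen so that `|C₀| + 1 + C ρ = C`, which closes the induction.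
  set C : ℝ := (|C₀| + 1) / (1 - ρ)
  have hC : C * (1 - ρ) = |C₀| + 1 := div_mul_cancel₀ _ hρ0.ne'
  have hCpos : 0 < C := by positivity
  refine ⟨C, r₀, hCpos, hr₀, ?_⟩
  have claim : ∀ n : ℕ, ∀ r, 0 < r → r < r₀ → ν.real (Metric.closedBall p r) ≤
      ν.real (Metric.closedBall p (r * (2 / 3) ^ n)) + C * r ^ δ := by
    intro n
    induction n with
    | zero =>
      intro r hr _
      have : 0 ≤ C * r ^ δ := by positivity
      simpa using this
    | succ n ih =>
      intro r hr hr'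
      have h1 := ih (r * (2 / 3)) (by positivity) (by linarith)
      have h2 := hC₀ (r / 3) (r * (2 / 3)) (by positivity) (by linarith) (by linarith)
      rw [show r * (2 / 3) + r / 3 = r by ring] at h2
      have h3 := (le_abs_self _).trans h2
      have h4 : C₀ * (r / 3) ^ δ ≤ (|C₀| + 1) * r ^ δ := by
        have : (r / 3) ^ δ ≤ r ^ δ := Real.rpow_le_rpow (by positivity) (by linarith) hδ.le
        have := le_abs_self C₀
        gcongr
        linarith
      have h5 : (r * (2 / 3)) ^ δ = r ^ δ * ρ := Real.mul_rpow hr.le (by norm_num)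
      have h6 : r * (2 / 3) * (2 / 3) ^ n = r * (2 / 3) ^ (n + 1) := by ring
      rw [h5, h6] at h1
      rw [← hC] at h4
      linarith
  intro r hr hr'
  have hlim : Tendsto (fun n : ℕ => ν.real (Metric.closedBall p (r * (2 / 3) ^ n)) + C * r ^ δ)
      atTop (𝓝 (0 + C * r ^ δ)) := by
    refine Tendsto.add_const _ ?_
    have h0 : ν.real (Metric.closedBall p 0) = 0 := by
      have := h 0
      rw [Metric.sphere_zero] at this
      simp [Measure.real, this]
    rw [← h0]
    refine ((continuous_measureReal_closedBall ν h).tendsto 0).comp ?_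
    simpa using (tendsto_pow_atTop_nhds_zero_of_lt_one (r := (2 / 3 : ℝ))
      (by norm_num) (by norm_num)).const_mul r
  simpa using ge_of_tendsto' hlim fun n => claim n r hr hr'

theorem integrable_ballCutoff (ν : Measure X) [IsProbabilityMeasure ν] (p : X) (r : ℝ) {ε : ℝ}
    (hε : 0 < ε) : Integrable (ballCutoff p r ε) ν :=
  Integrable.of_bound (lipschitzWith_ballCutoff p r hε).continuous.aestronglyMeasurable 1
    (Eventually.of_forall fun x => by
      rw [Real.norm_eq_abs, abs_of_nonneg (ballCutoff_nonneg p r ε x)]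
      exact ballCutoff_le_one p r ε x)

theorem integral_ballCutoff_le (ν : Measure X) [IsProbabilityMeasure ν] (p : X) (r : ℝ) {ε : ℝ}
    (hε : 0 < ε) : ∫ x, ballCutoff p r ε x ∂ν ≤ ν.real (Metric.closedBall p (r + ε)) := by
  have hm : MeasurableSet (Metric.closedBall p (r + ε)) :=
    Metric.isClosed_closedBall.measurableSet
  calc _ ≤ ∫ x, (Metric.closedBall p (r + ε)).indicator (fun _ => (1 : ℝ)) x ∂ν := by
        refine integral_mono (integrable_ballCutoff ν p r hε)
          ((integrable_const _).indicator hm) fun x => ?_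
        by_cases hx : x ∈ Metric.closedBall p (r + ε)
        · rw [Set.indicator_of_mem hx]
          exact ballCutoff_le_one p r ε x
        · rw [Set.indicator_of_notMem hx, ballCutoff_eq_zero hε hx]
    _ = _ := by
        rw [integral_indicator_const _ hm]
        simp

/-- Cutoffs of sup norm at most `1` and Lipschitz constant `ε⁻¹` dominate the indicators of the
balls and are supported in the enlarged ones. -/
theorem LipDecay.measureReal_inter_preimage_le {f : X → X} {ν : Measure X}
    [IsProbabilityMeasure ν] {Θ : ℕ → ℝ} (hΘ : LipDecay f ν Θ) (hf : Measurable f) (p : X)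
    (r₁ r₂ : ℝ) {ε₁ ε₂ : ℝ} (h₁ : 0 < ε₁) (h₂ : 0 < ε₂) (k : ℕ) :
    ν.real (Metric.closedBall p r₁ ∩ f^[k] ⁻¹' Metric.closedBall p r₂) ≤
      ν.real (Metric.closedBall p (r₁ + ε₁)) * ν.real (Metric.closedBall p (r₂ + ε₂)) +
        Θ k * (1 + ε₁⁻¹) * (1 + ε₂⁻¹) := by
  have hm : MeasurableSet (Metric.closedBall p r₁ ∩ f^[k] ⁻¹' Metric.closedBall p r₂) :=
    Metric.isClosed_closedBall.measurableSet.inter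
      (hf.iterate k Metric.isClosed_closedBall.measurableSet)
  have h := hΘ.2.2 (ballCutoff p r₁ ε₁) (ballCutoff p r₂ ε₂) 1 1 _ _
    (fun x => by rw [abs_of_nonneg (ballCutoff_nonneg ..)]; exact ballCutoff_le_one ..)
    (lipschitzWith_ballCutoff p r₁ h₁)
    (fun x => by rw [abs_of_nonneg (ballCutoff_nonneg ..)]; exact ballCutoff_le_one ..)
    (lipschitzWith_ballCutoff p r₂ h₂) k
  have h' := (le_abs_self _).trans h
  rw [NNReal.coe_mk, NNReal.coe_mk] at h'
  have h3 : ν.real (Metric.closedBall p r₁ ∩ f^[k] ⁻¹' Metric.closedBall p r₂) ≤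
      ∫ x, ballCutoff p r₁ ε₁ x * ballCutoff p r₂ ε₂ (f^[k] x) ∂ν := by
    calc _ = ∫ x, (Metric.closedBall p r₁ ∩ f^[k] ⁻¹' Metric.closedBall p r₂).indicator
          (fun _ => (1 : ℝ)) x ∂ν := by
          rw [integral_indicator_const _ hm]
          simp
      _ ≤ _ := by
          refine integral_mono ((integrable_const _).indicator hm) ?_ fun x => ?_
          · refine Integrable.of_bound (C := 1) ?_ (Eventually.of_forall fun x => ?_)
            · exact ((lipschitzWith_ballCutoff p r₁ h₁).continuous.measurable.mul
                ((lipschitzWith_ballCutoff p r₂ h₂).continuous.measurable.comp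
                  (hf.iterate k))).aestronglyMeasurable
            · rw [Real.norm_eq_abs, abs_of_nonneg
                (mul_nonneg (ballCutoff_nonneg ..) (ballCutoff_nonneg ..))]
              exact mul_le_one₀ (ballCutoff_le_one ..) (ballCutoff_nonneg ..)
                (ballCutoff_le_one ..)
          · by_cases hx : x ∈ Metric.closedBall p r₁ ∩ f^[k] ⁻¹' Metric.closedBall p r₂
            · rw [Set.indicator_of_mem hx, ballCutoff_eq_one h₁ hx.1, ballCutoff_eq_one h₂ hx.2,
                mul_one]
            · rw [Set.indicator_of_notMem hx]
              exact mul_nonneg (ballCutoff_nonneg ..) (ballCutoff_nonneg ..)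
  have h4 : (∫ x, ballCutoff p r₁ ε₁ x ∂ν) * ∫ x, ballCutoff p r₂ ε₂ x ∂ν ≤
      ν.real (Metric.closedBall p (r₁ + ε₁)) * ν.real (Metric.closedBall p (r₂ + ε₂)) := by
    gcongr
    · exact integral_nonneg fun x => ballCutoff_nonneg ..
    · exact integral_ballCutoff_le ν p r₁ h₁
    · exact integral_ballCutoff_le ν p r₂ h₂
  linarith

/-- Under annulus regularity, decay of correlations for Lipschitz observables gives decay of
correlations for small balls. -/
theorem LipDecay.exists_measureReal_inter_preimage_le {f : X → X} {ν : Measure X}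
    [IsProbabilityMeasure ν] {Θ : ℕ → ℝ} (hΘ : LipDecay f ν Θ) (hf : Measurable f) {p : X}
    {δ : ℝ} (hδ : 0 < δ) (h : ∀ t, ν (Metric.sphere p t) = 0) (hann : AnnulusRegular ν p δ)
    (hpos : ∀ r : ℝ, 0 < r → 0 < ν.real (Metric.closedBall p r)) :
    ∃ r₀ : ℝ, 0 < r₀ ∧ ∀ η : ℝ, 0 < η → ∃ C : ℝ, 0 < C ∧ ∀ r₁ r₂ : ℝ, 0 < r₁ → r₁ < r₀ →
      0 < r₂ → r₂ < r₀ → ∀ k : ℕ,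
      ν.real (Metric.closedBall p r₁ ∩ f^[k] ⁻¹' Metric.closedBall p r₂) ≤
        (1 + η) * (ν.real (Metric.closedBall p r₁) * ν.real (Metric.closedBall p r₂)) +
          C * Θ k * (ν.real (Metric.closedBall p r₁) * ν.real (Metric.closedBall p r₂)) ^
            (-δ⁻¹) := by
  obtain ⟨C₁, ρ₁, hC₁, hρ₁, hup⟩ := hann.exists_measureReal_closedBall_le hδ h
  obtain ⟨C₀, ρ₀, hρ₀, hC₀⟩ := hann
  refine ⟨min ρ₀ ρ₁, lt_min hρ₀ hρ₁, fun η hη => ?_⟩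
  -- Ensures `(1 + θ)² ≤ 1 + η`.
  set θ : ℝ := min 1 (η / 3)
  have hθ : 0 < θ := lt_min one_pos (by positivity)
  have hθ1 : θ ≤ 1 := min_le_left _ _
  have hθη : θ ≤ η / 3 := min_le_right _ _
  set κ : ℝ := min 1 (min (1 / (2 * C₁)) (θ / (|C₀| + 1)))
  have hκ : 0 < κ := lt_min one_pos (lt_min (by positivity) (by positivity))
  have hκ1 : κ ≤ 1 := min_le_left _ _
  have hκC : κ * C₁ < 1 := by
    have : κ ≤ 1 / (2 * C₁) := (min_le_right _ _).trans (min_le_left _ _)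
    rw [le_div_iff₀ (by positivity)] at this
    linarith
  have hκθ : C₀ * κ ≤ θ := by
    have : κ ≤ θ / (|C₀| + 1) := (min_le_right _ _).trans (min_le_right _ _)
    rw [le_div_iff₀ (by positivity)] at this
    nlinarith [le_abs_self C₀]
  -- The cutoff width is `ε = (κ m)^(1/δ)`, so the added annulus has measure at most `C₀ κ m ≤ θ m`
  -- and the Lipschitz constant is of order `m^(-1/δ)`. The bound `m ≤ C₁ r^δ` with `κ C₁ < 1` gives
  -- `ε < r`, without which annulus regularity does not apply.
  have key : ∀ r, 0 < r → r < min ρ₀ ρ₁ → ∃ ε : ℝ, 0 < ε ∧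
      ν.real (Metric.closedBall p (r + ε)) ≤ (1 + θ) * ν.real (Metric.closedBall p r) ∧
      1 + ε⁻¹ ≤ 2 * κ ^ (-δ⁻¹) * ν.real (Metric.closedBall p r) ^ (-δ⁻¹) := by
    intro r hr hr'
    set m := ν.real (Metric.closedBall p r) with hm
    have hm0 : 0 < m := hpos r hr
    have hm1 : m ≤ 1 := measureReal_le_one
    have hε : 0 < (κ * m) ^ δ⁻¹ := by positivity
    have hεδ : ((κ * m) ^ δ⁻¹) ^ δ = κ * m := Real.rpow_inv_rpow (by positivity) hδ.ne'
    have hεr : (κ * m) ^ δ⁻¹ < r := by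
      rw [← Real.rpow_lt_rpow_iff hε.le hr.le hδ, hεδ]
      have h1 := hup r hr (hr'.trans_le (min_le_right _ _))
      have h2 : 0 < r ^ δ := by positivity
      calc κ * m ≤ κ * (C₁ * r ^ δ) := by gcongr
        _ = κ * C₁ * r ^ δ := by ring
        _ < 1 * r ^ δ := by gcongr
        _ = r ^ δ := one_mul _
    refine ⟨(κ * m) ^ δ⁻¹, hε, ?_, ?_⟩
    · have h1 := (le_abs_self _).trans
        (hC₀ _ r hε hεr (hr'.trans_le (min_le_left _ _)))
      rw [hεδ, ← hm] at h1
      have : C₀ * (κ * m) ≤ θ * m := by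
        rw [← mul_assoc]
        gcongr
      linarith
    · have h1 : (κ * m) ^ δ⁻¹ ≤ 1 :=
        Real.rpow_le_one (by positivity) (mul_le_one₀ hκ1 hm0.le hm1) (inv_pos.2 hδ).le
      have h2 : 1 ≤ ((κ * m) ^ δ⁻¹)⁻¹ := (one_le_inv₀ hε).2 h1
      have h3 : ((κ * m) ^ δ⁻¹)⁻¹ = κ ^ (-δ⁻¹) * m ^ (-δ⁻¹) := by
        rw [← Real.rpow_neg (by positivity), Real.mul_rpow hκ.le hm0.le]
      rw [mul_assoc, ← h3]
      linarith
  refine ⟨(2 * κ ^ (-δ⁻¹)) ^ 2, by positivity, fun r₁ r₂ hr₁ hr₁' hr₂ hr₂' k => ?_⟩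
  obtain ⟨ε₁, hε₁, h1, h1'⟩ := key r₁ hr₁ hr₁'
  obtain ⟨ε₂, hε₂, h2, h2'⟩ := key r₂ hr₂ hr₂'
  refine (hΘ.measureReal_inter_preimage_le hf p r₁ r₂ hε₁ hε₂ k).trans ?_
  set m₁ := ν.real (Metric.closedBall p r₁)
  set m₂ := ν.real (Metric.closedBall p r₂)
  have hm₁ : 0 < m₁ := hpos r₁ hr₁
  have hm₂ : 0 < m₂ := hpos r₂ hr₂
  have hΘk := hΘ.nonneg k
  refine add_le_add ?_ ?_
  · calc _ ≤ (1 + θ) * m₁ * ((1 + θ) * m₂) := by gcongr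
      _ = (1 + θ) ^ 2 * (m₁ * m₂) := by ring
      _ ≤ _ := by
        gcongr
        nlinarith
  · calc _ ≤ Θ k * (2 * κ ^ (-δ⁻¹) * m₁ ^ (-δ⁻¹)) * (2 * κ ^ (-δ⁻¹) * m₂ ^ (-δ⁻¹)) := by
          gcongr
      _ = _ := by
          rw [Real.mul_rpow hm₁.le hm₂.le]
          ring

end Balls

/-! ### Dynamical Borel–Cantelli lemma, abstract form -/

open Classical in
/-- **Dynamical Borel–Cantelli lemma** for concentric balls: decay of correlations at rate `Θ`
together with few short returns up to the time horizon `g`. -/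
theorem ae_frequently_mem_closedBall_of_fewReturns {X : Type*} [MetricSpace X] [MeasurableSpace X]
    [BorelSpace X] {f : X → X} {ν : Measure X} [IsProbabilityMeasure ν]
    (hf : MeasurePreserving f ν ν) {p : X} {δ : ℝ} (hδ : 0 < δ)
    (h : ∀ t, ν (Metric.sphere p t) = 0) (hann : AnnulusRegular ν p δ)
    (hpos : ∀ r : ℝ, 0 < r → 0 < ν.real (Metric.closedBall p r))
    {Θ : ℕ → ℝ} (hΘ : LipDecay f ν Θ) {r : ℕ → ℝ} (hr : Antitone r) (hr0 : ∀ n, 0 < r n)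
    (hm : ∀ n : ℕ, ν.real (Metric.closedBall p (r n)) ≤ 1 / ((n : ℝ) + 2))
    (hdiv : ¬ Summable fun n => ν.real (Metric.closedBall p (r n)))
    {a : ℝ} (ha : 0 < a) {g : ℕ → ℝ} (hg : ∀ n, 0 ≤ g n) (hfew : FewReturns f ν p r a g)
    {κ : ℝ} (hκ : 0 < κ) {A : ℝ} (hA : ∀ᶠ i : ℕ in atTop, g i * (1 / ((i : ℝ) + 2)) ^ a ≤ A)
    {P Q : ℕ → ℝ} (hP : Summable P) (hQ : Summable Q) (hP0 : ∀ n, 0 ≤ P n) (hQ0 : ∀ n, 0 ≤ Q n)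
    (hB : ∀ᶠ i : ℕ in atTop, ∀ k : ℕ, 1 ≤ k → g i < k →
      Θ k * (((i : ℝ) + 1) * (((i + k : ℕ) : ℝ) + 1)) ^ ((1 + κ) * δ⁻¹) ≤
        (P i + P (i + k)) * Q k) :
    ∀ᵐ x ∂ν, ∃ᶠ n in atTop, f^[n] x ∈ Metric.closedBall p (r n) := by
  obtain ⟨r₀, hr₀, hpair⟩ :=
    hΘ.exists_measureReal_inter_preimage_le hf.measurable hδ h hann hpos
  set m : ℕ → ℝ := fun n => ν.real (Metric.closedBall p (r n)) with hmdef
  have hm0 : ∀ n, 0 < m n := fun n => hpos _ (hr0 n)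
  have hsmall : ∀ᶠ n in atTop, r n < r₀ := by
    have h1 : Tendsto (fun n : ℕ => 1 / ((n : ℝ) + 2)) atTop (𝓝 0) :=
      tendsto_const_nhds.div_atTop
        (tendsto_atTop_add_const_right _ _ tendsto_natCast_atTop_atTop)
    filter_upwards [h1.eventually (gt_mem_nhds (hpos r₀ hr₀))] with n hn
    by_contra! hc
    have := measureReal_closedBall_mono ν p hc
    have := hm n
    linarith
  obtain ⟨n₀, hn₀⟩ := eventually_atTop.1 (((hsmall.and hfew).and hA).and hB)
  -- Measures of large indices outside `G` are summable, so divergence survives on `G`; on `G`, `m n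
  -- ^ (-1/δ)` is at most a power of `n + 1`.
  set G : Set ℕ := {n | n₀ ≤ n ∧ ((n : ℝ) + 1) ^ (-(1 + κ)) ≤ m n} with hG
  set E : ℕ → Set X := fun n => if n ∈ G then f^[n] ⁻¹' Metric.closedBall p (r n) else ∅ with hE
  have hball : ∀ s : ℝ, MeasurableSet (Metric.closedBall p s) :=
    fun s => Metric.isClosed_closedBall.measurableSet
  have hEm : ∀ n, MeasurableSet (E n) := by
    intro n
    by_cases hn : n ∈ G
    · simp only [hE, if_pos hn]
      exact hf.measurable.iterate n (hball _)
    · simp only [hE, if_neg hn]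
      exact MeasurableSet.empty
  have hw : ∀ n, ν.real (E n) = if n ∈ G then m n else 0 := by
    intro n
    by_cases hn : n ∈ G
    · simp only [hE, if_pos hn]
      exact (hf.iterate n).measureReal_preimage (hball _).nullMeasurableSet
    · simp [hE, if_neg hn]
  have hEdiv : ¬ Summable fun n => ν.real (E n) := by
    intro hs
    apply hdiv
    have hs' : Summable fun n : ℕ => ((n : ℝ) + 1) ^ (-(1 + κ)) := by
      have := (summable_nat_add_iff 1).2
        (Real.summable_nat_rpow.2 (by linarith : -(1 + κ) < -1))
      simpa using this
    refine Summable.of_norm_bounded_eventually_nat (hs.add hs') ?_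
    filter_upwards [eventually_ge_atTop n₀] with n hn
    rw [Real.norm_eq_abs, abs_of_nonneg (hm0 n).le, hw]
    have h0 : (0 : ℝ) ≤ ((n : ℝ) + 1) ^ (-(1 + κ)) := by positivity
    by_cases hc : ((n : ℝ) + 1) ^ (-(1 + κ)) ≤ m n
    · rw [if_pos ⟨hn, hc⟩]
      linarith
    · rw [if_neg fun hh => hc hh.2]
      linarith
  have key : ∀ᵐ x ∂ν, ∃ᶠ n in atTop, x ∈ E n := by
    refine ae_frequently_mem_of_pair_bound ν hEm hEdiv fun η hη => ?_
    obtain ⟨C, hC, hpC⟩ := hpair η hη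
    refine ⟨fun i j => (if ((j - i : ℕ) : ℝ) ≤ g i then ν.real (E i) ^ (1 + a) else 0) +
      C * ((P i + P j) * Q (j - i)), max A 0 + C * (2 * ((∑' n, P n) * ∑' n, Q n)), ?_, ?_⟩
    · intro i j hij
      have hbnn : 0 ≤ C * ((P i + P j) * Q (j - i)) :=
        mul_nonneg hC.le (mul_nonneg (add_nonneg (hP0 _) (hP0 _)) (hQ0 _))
      have hbnn' : 0 ≤ if ((j - i : ℕ) : ℝ) ≤ g i then ν.real (E i) ^ (1 + a) else 0 := by
        split_ifs <;> positivity
      have hmain : 0 ≤ (1 + η) * (ν.real (E i) * ν.real (E j)) := by positivity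
      by_cases hi : i ∈ G
      swap
      · have : ν.real (E i ∩ E j) = 0 := by simp [hE, if_neg hi]
        rw [this]; linarith
      by_cases hj : j ∈ G
      swap
      · have : ν.real (E i ∩ E j) = 0 := by simp [hE, if_neg hj]
        rw [this]; linarith
      obtain ⟨k, rfl⟩ := Nat.exists_eq_add_of_lt hij
      rw [add_assoc] at *
      set l := k + 1 with hl
      have hl1 : 1 ≤ l := by omega
      have hEij : ν.real (E i ∩ E (i + l)) =
          ν.real (Metric.closedBall p (r i) ∩ f^[l] ⁻¹' Metric.closedBall p (r (i + l))) := by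
        have : E i ∩ E (i + l) = f^[i] ⁻¹'
            (Metric.closedBall p (r i) ∩ f^[l] ⁻¹' Metric.closedBall p (r (i + l))) := by
          simp only [hE, if_pos hi, if_pos hj]
          rw [Set.preimage_inter, ← Set.preimage_comp, ← Function.iterate_add, add_comm l i]
        rw [this]
        exact (hf.iterate i).measureReal_preimage
          ((hball _).inter (hf.measurable.iterate l (hball _))).nullMeasurableSet
      rw [hEij]
      simp only [Nat.add_sub_cancel_left] at hbnn hbnn' ⊢
      have hn := hn₀ i hi.1
      by_cases hlg : (l : ℝ) ≤ g i
      · have h1 := hn.1.1.2 l hl1 hlg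
        -- The radii decrease, so the later ball may be enlarged to the earlier one, making the
        -- event a return to a single ball.
        have h2 : ν.real (Metric.closedBall p (r i) ∩ f^[l] ⁻¹' Metric.closedBall p (r (i + l))) ≤
            ν.real (Metric.closedBall p (r i) ∩ f^[l] ⁻¹' Metric.closedBall p (r i)) :=
          measureReal_mono (Set.inter_subset_inter_right _ (Set.preimage_mono
            (Metric.closedBall_subset_closedBall (hr (by omega)))))
        have h3 : ν.real (E i) = m i := by rw [hw, if_pos hi]
        rw [if_pos hlg, h3]
        rw [h3] at hmain
        have : ν.real (Metric.closedBall p (r i)) ^ (1 + a) = m i ^ (1 + a) := rfl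
        linarith
      · have h1 := hpC (r i) (r (i + l)) (hr0 _) hn.1.1.1 (hr0 _) (hn₀ _ hj.1).1.1.1 l
        have h2 := hn.2 l hl1 (not_le.1 hlg)
        have h3 : (m i * m (i + l)) ^ (-δ⁻¹) ≤
            (((i : ℝ) + 1) * (((i + l : ℕ) : ℝ) + 1)) ^ ((1 + κ) * δ⁻¹) := by
          have h4 : (((i : ℝ) + 1) * (((i + l : ℕ) : ℝ) + 1)) ^ (-(1 + κ)) ≤
              m i * m (i + l) := by
            rw [Real.mul_rpow (by positivity) (by positivity)]
            exact mul_le_mul hi.2 hj.2 (by positivity) (hm0 i).le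
          calc _ ≤ ((((i : ℝ) + 1) * (((i + l : ℕ) : ℝ) + 1)) ^ (-(1 + κ))) ^ (-δ⁻¹) :=
                Real.rpow_le_rpow_of_nonpos (by positivity) h4 (by simp [hδ.le])
            _ = _ := by
                rw [← Real.rpow_mul (by positivity)]
                congr 1
                ring
        rw [if_neg hlg, hw, hw, if_pos hi, if_pos hj, zero_add]
        refine h1.trans (add_le_add le_rfl ?_)
        rw [mul_assoc]
        refine mul_le_mul_of_nonneg_left (le_trans ?_ h2) hC.le
        exact mul_le_mul_of_nonneg_left h3 (hΘ.nonneg l)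
    · intro N
      have hT : 0 ≤ ∑ i ∈ Finset.range N, ν.real (E i) := by positivity
      have hPQ : 0 ≤ 2 * ((∑' n, P n) * ∑' n, Q n) :=
        mul_nonneg zero_le_two (mul_nonneg (tsum_nonneg hP0) (tsum_nonneg hQ0))
      have e : ∀ i j, (if i < j then (if ((j - i : ℕ) : ℝ) ≤ g i then ν.real (E i) ^ (1 + a) else 0)
          + C * ((P i + P j) * Q (j - i)) else 0) =
          (if i < j ∧ ((j - i : ℕ) : ℝ) ≤ g i then ν.real (E i) ^ (1 + a) else 0) +
          C * (if i < j then (P i + P j) * Q (j - i) else 0) := by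
        intro i j
        by_cases h1 : i < j <;> simp [h1]
      simp only [e, Finset.sum_add_distrib, ← Finset.mul_sum]
      -- At most `g i` short gaps per `i`, each costing `m i ^ (1 + a)`; as `g i * m i ^ a ≤ A`, the
      -- total is linear in the sum of measures.
      have h1 : ∑ i ∈ Finset.range N, ∑ j ∈ Finset.range N,
          (if i < j ∧ ((j - i : ℕ) : ℝ) ≤ g i then ν.real (E i) ^ (1 + a) else 0) ≤
          max A 0 * ∑ i ∈ Finset.range N, ν.real (E i) := by
        rw [Finset.mul_sum]
        refine Finset.sum_le_sum fun i _ => ?_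
        refine (sum_ite_le_card (by positivity) (hg i) i N).trans ?_
        rw [hw]
        by_cases hi : i ∈ G
        · rw [if_pos hi, Real.rpow_add (hm0 i), Real.rpow_one, mul_comm (m i), ← mul_assoc]
          refine mul_le_mul_of_nonneg_right ?_ (hm0 i).le
          refine le_trans ?_ ((hn₀ i hi.1).1.2.trans (le_max_left _ _))
          exact mul_le_mul_of_nonneg_left
            (Real.rpow_le_rpow (hm0 i).le (hm i) ha.le) (hg i)
        · rw [if_neg hi, Real.zero_rpow (by linarith)]
          simp
      have h2 := mul_le_mul_of_nonneg_left (sum_sum_mul_sub_le hP hQ hP0 hQ0 N) hC.le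
      have h3 : 0 ≤ max A 0 := le_max_right _ _
      have h4 := mul_nonneg (mul_nonneg hC.le hPQ) hT
      nlinarith
  filter_upwards [key] with x hx
  refine hx.mono fun n hn => ?_
  by_cases hnG : n ∈ G
  · simpa [hE, if_pos hnG] using hn
  · simp [hE, if_neg hnG] at hn

/-! ### Summability of long-gap errors for each decay rate -/

theorem eventually_log_rpow_horizon {a : ℝ} (ha : 0 < a) (γ : ℝ) :
    ∀ᶠ i : ℕ in atTop, Real.log i ^ γ * (1 / ((i : ℝ) + 2)) ^ a ≤ 1 := by
  have h := (isLittleO_log_rpow_rpow_atTop γ ha).comp_tendsto tendsto_natCast_atTop_atTop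
  filter_upwards [h.bound one_pos] with i hi
  simp only [Function.comp_apply, Real.norm_eq_abs, one_mul] at hi
  have h1 : |(i : ℝ) ^ a| = (i : ℝ) ^ a := abs_of_nonneg (by positivity)
  have h2 : (i : ℝ) ^ a ≤ ((i : ℝ) + 2) ^ a :=
    Real.rpow_le_rpow (by positivity) (by linarith) ha.le
  rw [one_div, Real.inv_rpow (by positivity), ← div_eq_mul_inv, div_le_one (by positivity)]
  linarith [le_abs_self (Real.log i ^ γ)]

/-- This is where `γ > 1` matters: beyond time `(log i)^γ` an exponential is smaller than any given
power of `i`. -/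
theorem eventually_mul_log_succ_le {L γ : ℝ} (hL : 0 ≤ L) {l : ℝ} (hl : 0 < l) (hγ : 1 < γ) :
    ∀ᶠ i : ℕ in atTop, L * Real.log ((i : ℝ) + 1) ≤ l * Real.log i ^ γ := by
  have h1 : Tendsto (fun i : ℕ => Real.log (i : ℝ) ^ (γ - 1)) atTop atTop :=
    (tendsto_rpow_atTop (by linarith)).comp (Real.tendsto_log_atTop.comp
      tendsto_natCast_atTop_atTop)
  filter_upwards [h1.eventually_ge_atTop (2 * L / l), eventually_ge_atTop 2] with i hi hi2
  have hi2' : (2 : ℝ) ≤ i := by exact_mod_cast hi2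
  have hlog : 0 < Real.log i := Real.log_pos (by linarith)
  have h3 : Real.log ((i : ℝ) + 1) ≤ 2 * Real.log i := by
    have : Real.log ((i : ℝ) + 1) ≤ Real.log ((i : ℝ) ^ 2) :=
      Real.log_le_log (by positivity) (by nlinarith)
    rwa [Real.log_pow, Nat.cast_ofNat] at this
  have h4 : Real.log i ^ γ = Real.log i ^ (γ - 1) * Real.log i := by
    rw [← Real.rpow_add_one hlog.ne']
    congr 1
    ring
  rw [div_le_iff₀ hl] at hi
  calc L * Real.log ((i : ℝ) + 1) ≤ L * (2 * Real.log i) := by gcongr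
    _ = 2 * L * Real.log i := by ring
    _ ≤ Real.log i ^ (γ - 1) * l * Real.log i := by gcongr
    _ = _ := by rw [h4]; ring

/-- Exponentially small correlations beyond times `(log i)^γ`, `γ > 1`, are summable even after
multiplication by polynomials. -/
theorem exists_summable_bound_of_exponential {Θ : ℕ → ℝ} {θ : ℝ}
    (hθ : 0 < θ) (hθ1 : θ < 1) (hO : Θ =O[atTop] fun n : ℕ => θ ^ n) {γ : ℝ} (hγ : 1 < γ)
    {c : ℝ} :
    ∃ P Q : ℕ → ℝ, Summable P ∧ Summable Q ∧ (∀ n, 0 ≤ P n) ∧ (∀ n, 0 ≤ Q n) ∧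
      ∀ᶠ i : ℕ in atTop, ∀ k : ℕ, 1 ≤ k → Real.log i ^ γ < k →
        Θ k * (((i : ℝ) + 1) * (((i + k : ℕ) : ℝ) + 1)) ^ c ≤ (P i + P (i + k)) * Q k := by
  obtain ⟨C, hC, hCO⟩ := hO.exists_pos
  obtain ⟨k₀, hk₀⟩ := eventually_atTop.1 hCO.bound
  -- Splits `θ^k = s^k s^k`: one factor beats the polynomial in `i`, the other makes the sum over
  -- `k` converge.
  set s := Real.sqrt θ with hs
  have hs0 : 0 < s := Real.sqrt_pos.2 hθ
  have hs1 : s < 1 := by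
    rw [hs, Real.sqrt_lt' one_pos]
    simpa using hθ1
  have hss : s * s = θ := Real.mul_self_sqrt hθ.le
  obtain ⟨M, hM⟩ := exists_nat_ge c
  refine ⟨fun i => (((i : ℝ) + 1) ^ 2)⁻¹, fun k => C * (((k : ℝ) + 1) ^ M * s ^ k), ?_, ?_,
    fun n => by positivity, fun n => by positivity, ?_⟩
  · have := (summable_nat_add_iff 1).2 (Real.summable_nat_pow_inv.2 one_lt_two)
    simpa using this
  · refine Summable.mul_left C ?_
    have h1 : Summable fun n : ℕ => ((n : ℝ) ^ M * s ^ n : ℝ) :=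
      summable_pow_mul_geometric_of_norm_lt_one M (by
        rwa [Real.norm_eq_abs, abs_of_pos hs0])
    have h2 := ((summable_nat_add_iff 1).2 h1).mul_left s⁻¹
    refine h2.congr fun n => ?_
    rw [pow_succ]
    push_cast
    field_simp
  · have hl : 0 < -Real.log s := neg_pos.2 (Real.log_neg hs0 hs1)
    have hgt : Tendsto (fun i : ℕ => Real.log (i : ℝ) ^ γ) atTop atTop :=
      (tendsto_rpow_atTop (by linarith)).comp (Real.tendsto_log_atTop.comp
        tendsto_natCast_atTop_atTop)
    filter_upwards [hgt.eventually_ge_atTop (k₀ : ℝ), eventually_mul_log_succ_le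
      (by positivity : (0 : ℝ) ≤ 2 * M + 2) hl hγ] with i hi hi' k hk1 hk
    have hkk : k₀ ≤ k := by exact_mod_cast (hi.trans hk.le)
    have hΘ : Θ k ≤ C * θ ^ k := by
      have := hk₀ k hkk
      rw [Real.norm_eq_abs, Real.norm_eq_abs, abs_of_pos (pow_pos hθ k)] at this
      exact (le_abs_self _).trans this
    set x : ℝ := (i : ℝ) + 1
    have hx : 1 ≤ x := by simp [x]
    have hx0 : 0 < x := by linarith
    have hk0 : (0 : ℝ) ≤ k := Nat.cast_nonneg k
    -- Of the exponent, `2M` cancels the polynomial in `x` and the extra `2` provides `P i`.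
    have hsk : s ^ k ≤ (x ^ (2 * M + 2))⁻¹ := by
      have h1 : Real.log (s ^ k) ≤ Real.log ((x ^ (2 * M + 2))⁻¹) := by
        rw [Real.log_pow, Real.log_inv, Real.log_pow]
        push_cast
        have : -Real.log s * Real.log i ^ γ ≤ -Real.log s * k := by gcongr
        linarith
      exact (Real.log_le_log_iff (by positivity) (by positivity)).1 h1
    have hy : x * (((i + k : ℕ) : ℝ) + 1) ≤ x ^ 2 * ((k : ℝ) + 1) := by
      push_cast
      have : (i : ℝ) + k + 1 ≤ x * ((k : ℝ) + 1) := by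
        simp only [x]
        nlinarith [Nat.cast_nonneg (α := ℝ) i]
      calc _ ≤ x * (x * ((k : ℝ) + 1)) := by gcongr
        _ = _ := by ring
    have hone : 1 ≤ x * (((i + k : ℕ) : ℝ) + 1) := by
      have : (0 : ℝ) ≤ ((i + k : ℕ) : ℝ) := Nat.cast_nonneg _
      nlinarith
    have hpow : (x * (((i + k : ℕ) : ℝ) + 1)) ^ c ≤ x ^ (2 * M) * ((k : ℝ) + 1) ^ M := by
      calc _ ≤ (x * (((i + k : ℕ) : ℝ) + 1)) ^ (M : ℝ) :=
            Real.rpow_le_rpow_of_exponent_le hone hM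
        _ = (x * (((i + k : ℕ) : ℝ) + 1)) ^ M := Real.rpow_natCast _ _
        _ ≤ (x ^ 2 * ((k : ℝ) + 1)) ^ M := by gcongr
        _ = _ := by rw [mul_pow, pow_mul]
    calc _ ≤ C * θ ^ k * (x ^ (2 * M) * ((k : ℝ) + 1) ^ M) := by gcongr
      _ = x ^ (2 * M) * s ^ k * (C * (((k : ℝ) + 1) ^ M * s ^ k)) := by
          rw [← hss, mul_pow]
          ring
      _ ≤ x ^ (2 * M) * (x ^ (2 * M + 2))⁻¹ * (C * (((k : ℝ) + 1) ^ M * s ^ k)) := by gcongr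
      _ = (x ^ 2)⁻¹ * (C * (((k : ℝ) + 1) ^ M * s ^ k)) := by
          congr 1
          rw [pow_add]
          field_simp
      _ ≤ _ := by
          gcongr
          simp only [le_add_iff_nonneg_right]
          positivity

/-- Correlations of order `k^{-ζ}` beyond times `i^γ`, `γ < 1`, are summable even after
multiplication by small polynomials. -/
theorem exists_summable_bound_of_polynomial {Θ : ℕ → ℝ} {ζ : ℝ}
    (hζ : 1 < ζ) (hO : Θ =O[atTop] fun n : ℕ => (n : ℝ) ^ (-ζ)) {γ : ℝ} (hγ0 : 0 < γ)
    (hγ : γ < 1) {σ : ℝ} (hσ : 0 < σ) (hs : 2 * σ + 1 < γ * (ζ - 1)) :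
    ∃ κ : ℝ, 0 < κ ∧ ∃ P Q : ℕ → ℝ,
      Summable P ∧ Summable Q ∧ (∀ n, 0 ≤ P n) ∧ (∀ n, 0 ≤ Q n) ∧
      ∀ᶠ i : ℕ in atTop, ∀ k : ℕ, 1 ≤ k → (i : ℝ) ^ γ < k →
        Θ k * (((i : ℝ) + 1) * (((i + k : ℕ) : ℝ) + 1)) ^ ((1 + κ) * σ) ≤
          (P i + P (i + k)) * Q k := by
  obtain ⟨C, hC, hCO⟩ := hO.exists_pos
  obtain ⟨k₀, hk₀⟩ := eventually_atTop.1 hCO.bound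
  -- The slack in `hs` is shared: `τ = e/4` makes `k^(-(1 + τ))` summable, `κ σ = e/8` pays for the
  -- lower cutoff on measures, and since `γ < 1` at least `e/2` is left for `P`.
  set e := γ * (ζ - 1) - (2 * σ + 1) with he
  have he0 : 0 < e := by linarith
  set τ := e / 4 with hτ
  have hτ0 : 0 < τ := by positivity
  have hw : 0 < ζ - 1 - τ := by nlinarith
  have hexp : 2 * ((1 + e / σ / 8) * σ) - γ * (ζ - 1 - τ) ≤ -(1 + e / 2) := by
    have : (1 + e / σ / 8) * σ = σ + e / 8 := by field_simp
    rw [this]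
    nlinarith
  refine ⟨e / σ / 8, by positivity, fun j => ((j : ℝ) + 1) ^ (-(1 + e / 2)),
    fun k => C * 3 ^ (ζ - 1 - τ) * (k : ℝ) ^ (-(1 + τ)), ?_, ?_, fun n => by positivity,
    fun n => by positivity, ?_⟩
  · have := (summable_nat_add_iff 1).2
      (Real.summable_nat_rpow.2 (by linarith : -(1 + e / 2) < -1))
    simpa using this
  · exact (Real.summable_nat_rpow.2 (by linarith : -(1 + τ) < -1)).mul_left _
  · have hgt : Tendsto (fun i : ℕ => (i : ℝ) ^ γ) atTop atTop :=
      (tendsto_rpow_atTop hγ0).comp tendsto_natCast_atTop_atTop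
    filter_upwards [hgt.eventually_ge_atTop (k₀ : ℝ)] with i hi k hk1 hk
    have hkk : k₀ ≤ k := by exact_mod_cast (hi.trans hk.le)
    have hk1' : (1 : ℝ) ≤ k := by exact_mod_cast hk1
    have hk0 : (0 : ℝ) < k := by linarith
    have hΘ : Θ k ≤ C * (k : ℝ) ^ (-ζ) := by
      have := hk₀ k hkk
      rw [Real.norm_eq_abs, Real.norm_eq_abs,
        abs_of_nonneg (by positivity : (0 : ℝ) ≤ (k : ℝ) ^ (-ζ))] at this
      exact (le_abs_self _).trans this
    set y : ℝ := ((i + k : ℕ) : ℝ) + 1 with hy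
    have hy1 : 1 ≤ y := by simp only [hy, le_add_iff_nonneg_left]; positivity
    have hy0 : 0 < y := by linarith
    -- Subadditivity of `t ^ γ` for `γ < 1` and `i ^ γ < k`; it lets part of the decay in `k` be
    -- spent as decay in `i + k`.
    have hyk : y ^ γ ≤ 3 * k := by
      have h1 : y = (i : ℝ) + ((k : ℝ) + 1) := by simp only [hy]; push_cast; ring
      have h2 : ((i : ℝ) + ((k : ℝ) + 1)) ^ γ ≤ (i : ℝ) ^ γ + ((k : ℝ) + 1) ^ γ :=
        Real.rpow_add_le_add_rpow (by positivity) (by positivity) hγ0.le hγ.le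
      have h3 : ((k : ℝ) + 1) ^ γ ≤ (k : ℝ) + 1 := by
        simpa using Real.rpow_le_rpow_of_exponent_le (by linarith : 1 ≤ (k : ℝ) + 1) hγ.le
      rw [h1]
      linarith
    have hkw : (k : ℝ) ^ (-(ζ - 1 - τ)) ≤ 3 ^ (ζ - 1 - τ) * y ^ (-(γ * (ζ - 1 - τ))) := by
      have h1 : (y ^ γ) ^ (ζ - 1 - τ) ≤ (3 * k) ^ (ζ - 1 - τ) :=
        Real.rpow_le_rpow (by positivity) hyk hw.le
      rw [← Real.rpow_mul hy0.le, Real.mul_rpow (by norm_num) hk0.le] at h1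
      rw [Real.rpow_neg hk0.le, Real.rpow_neg hy0.le, ← div_eq_mul_inv,
        le_div_iff₀ (by positivity), inv_mul_le_iff₀ (by positivity), mul_comm (_ ^ _)]
      exact h1
    have hsplit : (k : ℝ) ^ (-ζ) = (k : ℝ) ^ (-(1 + τ)) * (k : ℝ) ^ (-(ζ - 1 - τ)) := by
      rw [← Real.rpow_add hk0]
      congr 1
      ring
    have hbase : (((i : ℝ) + 1) * y) ^ ((1 + e / σ / 8) * σ) ≤
        y ^ (2 * ((1 + e / σ / 8) * σ)) := by
      rw [Real.rpow_mul hy0.le, Real.rpow_two, sq]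
      refine Real.rpow_le_rpow (by positivity) ?_ (by positivity)
      gcongr
      simp only [hy]
      push_cast
      linarith
    calc _ ≤ C * ((k : ℝ) ^ (-(1 + τ)) * (3 ^ (ζ - 1 - τ) * y ^ (-(γ * (ζ - 1 - τ))))) *
          y ^ (2 * ((1 + e / σ / 8) * σ)) := by
          refine mul_le_mul (hΘ.trans ?_) hbase (by positivity) (by positivity)
          rw [hsplit]
          gcongr
      _ = y ^ (2 * ((1 + e / σ / 8) * σ) - γ * (ζ - 1 - τ)) *
          (C * 3 ^ (ζ - 1 - τ) * (k : ℝ) ^ (-(1 + τ))) := by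
          rw [sub_eq_add_neg (2 * ((1 + e / σ / 8) * σ)), Real.rpow_add hy0]
          ring
      _ ≤ y ^ (-(1 + e / 2)) * (C * 3 ^ (ζ - 1 - τ) * (k : ℝ) ^ (-(1 + τ))) := by
          gcongr
      _ ≤ _ := by
          gcongr
          simp only [hy, le_add_iff_nonneg_left]
          positivity

/-! ### Superlinear return horizons are impossible -/

/-- A measure preserving map cannot have so few returns to sets of measure `1 / (n + 2)` up to
superlinear times: the expected number of returns up to time `2 (n + 2)` would be too small. -/
theorem not_fewReturns_of_one_lt {X : Type*} [MetricSpace X] [MeasurableSpace X]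
    [BorelSpace X] {f : X → X} {ν : Measure X} [IsProbabilityMeasure ν]
    (hf : MeasurePreserving f ν ν) {p : X} {r : ℕ → ℝ}
    (hm : ∀ n : ℕ, ν.real (Metric.closedBall p (r n)) = 1 / ((n : ℝ) + 2))
    {a γ : ℝ} (ha : 1 < a) (hγ : 1 < γ) :
    ¬ FewReturns f ν p r a (fun n => (n : ℝ) ^ γ) := by
  intro hfew
  have h1 : Tendsto (fun n : ℕ => (n : ℝ) ^ (γ - 1)) atTop atTop :=
    (tendsto_rpow_atTop (by linarith)).comp tendsto_natCast_atTop_atTop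
  have h2 : Tendsto (fun n : ℕ => ((n : ℝ) + 2) ^ (a - 1)) atTop atTop :=
    (tendsto_rpow_atTop (by linarith)).comp
      (tendsto_atTop_add_const_right _ _ tendsto_natCast_atTop_atTop)
  obtain ⟨n, ⟨⟨hn1, hn2⟩, hn3⟩, hn4⟩ := (((hfew.and (h1.eventually_ge_atTop 4)).and
    (h2.eventually_gt_atTop 2)).and (eventually_ge_atTop 2)).exists
  have hn4' : (2 : ℝ) ≤ n := by exact_mod_cast hn4
  have hball : MeasurableSet (Metric.closedBall p (r n)) :=
    Metric.isClosed_closedBall.measurableSet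
  set E : ℕ → Set X := fun i => f^[i] ⁻¹' Metric.closedBall p (r n) with hE
  have hEm : ∀ i, MeasurableSet (E i) := fun i => hf.measurable.iterate i hball
  set m : ℝ := 1 / ((n : ℝ) + 2) with hmdef
  have hm0 : 0 < m := by positivity
  have hw : ∀ i, ν.real (E i) = m := fun i => by
    rw [hmdef, ← hm n]
    exact (hf.iterate i).measureReal_preimage hball.nullMeasurableSet
  have hg : (2 * ((n : ℝ) + 2)) ≤ (n : ℝ) ^ γ := by
    have : (n : ℝ) ^ γ = (n : ℝ) ^ (γ - 1) * n := by
      rw [← Real.rpow_add_one (by positivity)]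
      congr 1
      ring
    rw [this]
    nlinarith
  have hlt : ∀ i j, i < j → j < 2 * (n + 2) → ν.real (E i ∩ E j) ≤ m ^ (1 + a) := by
    intro i j hij hj
    have e : E i ∩ E j = f^[i] ⁻¹' (Metric.closedBall p (r n) ∩
        f^[j - i] ⁻¹' Metric.closedBall p (r n)) := by
      simp only [hE]
      rw [Set.preimage_inter, ← Set.preimage_comp, ← Function.iterate_add,
        Nat.sub_add_cancel hij.le]
    rw [e, (hf.iterate i).measureReal_preimage
      (hball.inter (hf.measurable.iterate _ hball)).nullMeasurableSet, hmdef, ← hm n]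
    refine hn1 (j - i) (by omega) (le_trans ?_ hg)
    have : j - i ≤ 2 * (n + 2) := by omega
    exact_mod_cast this
  have hle : ∀ i ∈ Finset.range (2 * (n + 2)), ∀ j ∈ Finset.range (2 * (n + 2)),
      ν.real (E i ∩ E j) ≤ (if i = j then m else 0) + m ^ (1 + a) := by
    intro i hi j hj
    rw [Finset.mem_range] at hi hj
    have : 0 ≤ m ^ (1 + a) := by positivity
    rcases lt_trichotomy i j with hij | hij | hij
    · simpa [hij.ne] using hlt i j hij hj
    · subst hij
      rw [Set.inter_self, hw]
      simpa using this
    · rw [Set.inter_comm]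
      simpa [hij.ne'] using hlt j i hij hi
  -- The expected number of hits is `2`, so the second moment is at least `4`; few returns would
  -- bound it by `2 + 4 (n + 2)^(-(a - 1)) < 4`.
  have hsq := (sq_sum_measureReal_le ν hEm (2 * (n + 2))).trans
    (Finset.sum_le_sum fun i hi => Finset.sum_le_sum (hle i hi))
  have hd : ∑ i ∈ Finset.range (2 * (n + 2)), ∑ j ∈ Finset.range (2 * (n + 2)),
      ((if i = j then m else 0) + m ^ (1 + a)) =
      2 * ((n : ℝ) + 2) * m + (2 * ((n : ℝ) + 2)) ^ 2 * m ^ (1 + a) := by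
    have : ∀ i ∈ Finset.range (2 * (n + 2)), ∑ j ∈ Finset.range (2 * (n + 2)),
        ((if i = j then m else 0) + m ^ (1 + a)) = m + 2 * ((n : ℝ) + 2) * m ^ (1 + a) := by
      intro i hi
      rw [Finset.sum_add_distrib, Finset.sum_ite_eq, if_pos hi]
      simp
    rw [Finset.sum_congr rfl this]
    simp
    ring
  rw [hd] at hsq
  simp only [hw, Finset.sum_const, Finset.card_range, nsmul_eq_mul] at hsq
  push_cast at hsq
  have hKm : ((n : ℝ) + 2) * m = 1 := by
    rw [hmdef]
    field_simp
  have hma : m ^ (1 + a) = m ^ 2 * (((n : ℝ) + 2) ^ (a - 1))⁻¹ := by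
    rw [show 1 + a = 2 + (a - 1) by ring, Real.rpow_add hm0, Real.rpow_two]
    congr 1
    rw [hmdef, one_div, Real.inv_rpow (by positivity)]
  have hsmall : (((n : ℝ) + 2) ^ (a - 1))⁻¹ < 1 / 2 := by
    rw [one_div]
    exact inv_strictAnti₀ two_pos hn3
  have e1 : (2 * ((n : ℝ) + 2) * m) = 2 := by linarith
  have e2 : (2 * ((n : ℝ) + 2)) ^ 2 * m ^ (1 + a) = 4 * (((n : ℝ) + 2) ^ (a - 1))⁻¹ := by
    rw [hma]
    calc _ = (2 * ((n : ℝ) + 2) * m) ^ 2 * (((n : ℝ) + 2) ^ (a - 1))⁻¹ := by ring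
      _ = _ := by rw [e1]; norm_num
  rw [e1, e2] at hsq
  linarith

/-! ### Capping the measures -/

/-- Cauchy condensation: if the capped series converged, its condensed terms would tend to `0`,
whereas `2^k / (2^k + 2) ≥ 1/3`. So the minimum at `2^k` is eventually `x (2^k)`, and the condensed
series of `x` converges too. -/
theorem not_summable_min_one_div {x : ℕ → ℝ} (hx : Antitone x) (hx0 : ∀ n, 0 ≤ x n)
    (h : ¬ Summable x) : ¬ Summable fun n : ℕ => min (x n) (1 / ((n : ℝ) + 2)) := by
  intro hs
  apply h
  have hnn : ∀ n : ℕ, 0 ≤ min (x n) (1 / ((n : ℝ) + 2)) := fun n =>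
    le_min (hx0 n) (by positivity)
  rw [← summable_condensed_iff_of_nonneg hnn] at hs
  swap
  · intro a b _ hab
    refine min_le_min (hx hab) ?_
    gcongr
  rw [← summable_condensed_iff_of_nonneg hx0 fun _ _ _ hab => hx hab]
  refine Summable.of_norm_bounded_eventually_nat hs ?_
  filter_upwards [hs.tendsto_atTop_zero.eventually (gt_mem_nhds (by norm_num : (0 : ℝ) < 1 / 3))]
    with k hk
  have h2 : (1 : ℝ) ≤ 2 ^ k := one_le_pow₀ one_le_two
  have h3 : 0 ≤ x (2 ^ k) := hx0 _
  rw [Real.norm_eq_abs, abs_of_nonneg (by positivity)]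
  push_cast at hk ⊢
  rcases le_total (x (2 ^ k)) (1 / ((2 : ℝ) ^ k + 2)) with h1 | h1
  · rw [min_eq_left h1]
  · rw [min_eq_right h1, mul_one_div, div_lt_div_iff₀ (by positivity) (by norm_num)] at hk
    linarith

theorem testRadii_of_le_one_div {X : Type*} [MetricSpace X] [MeasurableSpace X] {ν : Measure X}
    {p : X} {r : ℕ → ℝ} (hr0 : ∀ n, 0 < r n)
    (hm : ∀ n : ℕ, ν.real (Metric.closedBall p (r n)) ≤ 1 / ((n : ℝ) + 2))
    (hdiv : ¬ Summable fun n => ν.real (Metric.closedBall p (r n))) {ε : ℝ} (hε : 0 < ε) :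
    TestRadii ν p ε r := by
  refine ⟨hr0, hdiv, IsBigO.of_bound 1 ?_⟩
  filter_upwards [eventually_ge_atTop 1] with n hn
  have hn' : (1 : ℝ) ≤ n := by exact_mod_cast hn
  rw [Real.norm_eq_abs, Real.norm_eq_abs, abs_of_nonneg measureReal_nonneg,
    abs_of_nonneg (by positivity), one_mul]
  calc _ ≤ 1 / ((n : ℝ) + 2) := hm n
    _ ≤ 1 / (n : ℝ) := by
        gcongr
        linarith
    _ = (n : ℝ) ^ (-1 : ℝ) := by rw [Real.rpow_neg_one, one_div]
    _ ≤ _ := Real.rpow_le_rpow_of_exponent_le hn' (by linarith)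

theorem not_summable_one_div_nat_add_two : ¬ Summable fun n : ℕ => 1 / ((n : ℝ) + 2) := by
  intro h
  refine Real.not_summable_one_div_natCast ((summable_nat_add_iff 2).1 ?_)
  simpa using h

/-! ### Dynamical Borel–Cantelli lemma in the two mixing cases -/

section DynamicalBorelCantelli

variable {X : Type*} [MetricSpace X] [MeasurableSpace X] [BorelSpace X] {f : X → X}
  {ν : Measure X} [IsProbabilityMeasure ν] {p : X} {δ : ℝ} {Θ : ℕ → ℝ} {r : ℕ → ℝ}

theorem exists_antitone_radii (h : ∀ t, ν (Metric.sphere p t) = 0) :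
    ∃ s : ℕ → ℝ, Antitone s ∧ (∀ n, 0 < s n) ∧
      ∀ n : ℕ, ν.real (Metric.closedBall p (s n)) = 1 / ((n : ℝ) + 2) := by
  have hex : ∀ n : ℕ, ∃ s : ℝ, 0 < s ∧ ν.real (Metric.closedBall p s) = 1 / ((n : ℝ) + 2) :=
    fun n => exists_measureReal_closedBall_eq ν h (by positivity) (by
      rw [div_lt_one (by positivity)]
      have : (0 : ℝ) ≤ n := Nat.cast_nonneg n
      linarith)
  choose s hs0 hs using hex
  refine ⟨s, antitone_nat_of_succ_le fun n => ?_, hs0, hs⟩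
  by_contra! hc
  have h1 := measureReal_closedBall_mono ν p hc.le
  rw [hs, hs, one_div_le_one_div (by positivity) (by positivity)] at h1
  push_cast at h1
  linarith

theorem ae_frequently_mem_closedBall_of_log (hf : MeasurePreserving f ν ν) (hδ : 0 < δ)
    (h : ∀ t, ν (Metric.sphere p t) = 0) (hann : AnnulusRegular ν p δ)
    (hpos : ∀ r : ℝ, 0 < r → 0 < ν.real (Metric.closedBall p r))
    (hΘ : LipDecay f ν Θ) (hr : Antitone r) (hr0 : ∀ n, 0 < r n)
    (hm : ∀ n : ℕ, ν.real (Metric.closedBall p (r n)) ≤ 1 / ((n : ℝ) + 2))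
    (hdiv : ¬ Summable fun n => ν.real (Metric.closedBall p (r n)))
    {θ : ℝ} (hθ : 0 < θ) (hθ1 : θ < 1) (hO : Θ =O[atTop] fun n : ℕ => θ ^ n)
    (hno : NoShortReturnsLog f ν p) :
    ∀ᵐ x ∂ν, ∃ᶠ n in atTop, f^[n] x ∈ Metric.closedBall p (r n) := by
  obtain ⟨ε, hε, hno⟩ := hno
  obtain ⟨a, γ, ha, hγ, hfew⟩ := hno r (testRadii_of_le_one_div hr0 hm hdiv hε)
  -- Here `κ = 1`; exponential decay tolerates any polynomial factor.
  obtain ⟨P, Q, hP, hQ, hP0, hQ0, hB⟩ :=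
    exists_summable_bound_of_exponential hθ hθ1 hO hγ (c := (1 + 1) * δ⁻¹)
  exact ae_frequently_mem_closedBall_of_fewReturns hf hδ h hann hpos hΘ hr hr0 hm hdiv ha
    (fun n => Real.rpow_nonneg (Real.log_natCast_nonneg n) γ) hfew one_pos
    (eventually_log_rpow_horizon ha γ) hP hQ hP0 hQ0 hB

theorem ae_frequently_mem_closedBall_of_poly (hf : MeasurePreserving f ν ν) (hδ : 0 < δ)
    (h : ∀ t, ν (Metric.sphere p t) = 0) (hann : AnnulusRegular ν p δ)
    (hpos : ∀ r : ℝ, 0 < r → 0 < ν.real (Metric.closedBall p r))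
    (hΘ : LipDecay f ν Θ) (hr : Antitone r) (hr0 : ∀ n, 0 < r n)
    (hm : ∀ n : ℕ, ν.real (Metric.closedBall p (r n)) ≤ 1 / ((n : ℝ) + 2))
    (hdiv : ¬ Summable fun n => ν.real (Metric.closedBall p (r n)))
    {ζ : ℝ} (hζ : 1 < ζ) (hO : Θ =O[atTop] fun n : ℕ => (n : ℝ) ^ (-ζ))
    (hno : NoShortReturnsPoly f ν p ((2 * δ⁻¹ + 1) / (ζ - 1))) :
    ∀ᵐ x ∂ν, ∃ᶠ n in atTop, f^[n] x ∈ Metric.closedBall p (r n) := by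
  obtain ⟨ε, hε, hno⟩ := hno
  have hζ0 : 0 < ζ - 1 := by linarith
  have hs0 : 0 < (2 * δ⁻¹ + 1) / (ζ - 1) := by positivity
  -- A threshold of at least `1` would force `a, γ > 1`, which fails for balls of measure `1 / (n +
  -- 2)`.
  rcases lt_or_ge ((2 * δ⁻¹ + 1) / (ζ - 1)) 1 with hs1 | hs1
  · obtain ⟨a, γ, ha, hγ, hfew⟩ := hno r (testRadii_of_le_one_div hr0 hm hdiv hε)
    -- The horizon is shortened: `γ' < 1` for subadditivity, `γ' ≤ a` to keep short gaps affordable,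
    -- and `γ'` above the threshold for summability of the long ones.
    obtain ⟨γ', h1, h2⟩ := exists_between (lt_min hs1 (lt_min ha hγ))
    have hγ1 : γ' < 1 := h2.trans_le (min_le_left _ _)
    have hγa : γ' ≤ a := (h2.trans_le ((min_le_right _ _).trans (min_le_left _ _))).le
    have hγγ : γ' ≤ γ := (h2.trans_le ((min_le_right _ _).trans (min_le_right _ _))).le
    have hγ0 : 0 < γ' := hs0.trans h1
    rw [div_lt_iff₀ hζ0] at h1
    obtain ⟨κ, hκ, P, Q, hP, hQ, hP0, hQ0, hB⟩ :=
      exists_summable_bound_of_polynomial hζ hO hγ0 hγ1 (inv_pos.2 hδ) h1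
    have hfew' : FewReturns f ν p r a (fun n => (n : ℝ) ^ γ') := by
      filter_upwards [hfew, eventually_ge_atTop 1] with n hn hn1 k hk hk'
      exact hn k hk (hk'.trans
        (Real.rpow_le_rpow_of_exponent_le (by exact_mod_cast hn1) hγγ))
    refine ae_frequently_mem_closedBall_of_fewReturns hf hδ h hann hpos hΘ hr hr0 hm hdiv
      (hs0.trans ha) (fun n => by positivity) hfew' hκ (A := 1)
      (Eventually.of_forall fun i => ?_) hP hQ hP0 hQ0 hB
    have h3 : (1 : ℝ) ≤ (i : ℝ) + 2 := by
      have : (0 : ℝ) ≤ i := Nat.cast_nonneg i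
      linarith
    have h4 : (i : ℝ) ^ γ' ≤ ((i : ℝ) + 2) ^ a :=
      (Real.rpow_le_rpow (by positivity) (by linarith) hγ0.le).trans
        (Real.rpow_le_rpow_of_exponent_le h3 hγa)
    rwa [one_div, Real.inv_rpow (by positivity), ← div_eq_mul_inv, div_le_one (by positivity)]
  · obtain ⟨s, -, hsp, hsm⟩ := exists_antitone_radii h
    obtain ⟨a, γ, ha, hγ, hfew⟩ := hno s (testRadii_of_le_one_div hsp (fun n => (hsm n).le)
      (by simpa only [hsm] using not_summable_one_div_nat_add_two) hε)
    exact absurd hfew (not_fewReturns_of_one_lt hf hsm (hs1.trans_lt ha) (hs1.trans_lt hγ))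

/-- Dynamical Borel–Cantelli lemma for arbitrary shrinking balls about `p`. -/
theorem ae_frequently_mem_closedBall_of_mixing (hf : MeasurePreserving f ν ν) (hδ : 0 < δ)
    (h : ∀ t, ν (Metric.sphere p t) = 0) (hann : AnnulusRegular ν p δ)
    (hpos : ∀ r : ℝ, 0 < r → 0 < ν.real (Metric.closedBall p r))
    (hmix :
      (∃ (Θ : ℕ → ℝ) (θ : ℝ), LipDecay f ν Θ ∧ 0 < θ ∧ θ < 1 ∧
        (Θ =O[atTop] fun n : ℕ => θ ^ n) ∧ NoShortReturnsLog f ν p) ∨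
      (∃ (Θ : ℕ → ℝ) (ζ : ℝ), LipDecay f ν Θ ∧ 1 < ζ ∧
        (Θ =O[atTop] fun n : ℕ => (n : ℝ) ^ (-ζ)) ∧
        NoShortReturnsPoly f ν p ((2 * δ⁻¹ + 1) / (ζ - 1))))
    (hr : Antitone r) (hr0 : ∀ n, 0 < r n)
    (hdiv : ¬ Summable fun n => ν.real (Metric.closedBall p (r n))) :
    ∀ᵐ x ∂ν, ∃ᶠ n in atTop, f^[n] x ∈ Metric.closedBall p (r n) := by
  -- Shrinking the balls to measure at most `1 / (n + 2)` is harmless, since hits of the smaller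
  -- balls are hits of the original ones.
  obtain ⟨s, hs, hs0, hsm⟩ := exists_antitone_radii h
  have hmono : Monotone fun t : ℝ => ν.real (Metric.closedBall p t) :=
    fun _ _ hab => measureReal_closedBall_mono ν p hab
  have hmin : ∀ n, ν.real (Metric.closedBall p (min (r n) (s n))) =
      min (ν.real (Metric.closedBall p (r n))) (1 / ((n : ℝ) + 2)) := fun n => by
    rw [← hsm n]
    exact hmono.map_min
  have hr' : Antitone fun n => min (r n) (s n) := fun _ _ hab => min_le_min (hr hab) (hs hab)
  have hr0' : ∀ n, 0 < min (r n) (s n) := fun n => lt_min (hr0 n) (hs0 n)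
  have hm' : ∀ n : ℕ, ν.real (Metric.closedBall p (min (r n) (s n))) ≤ 1 / ((n : ℝ) + 2) :=
    fun n => (hmin n).trans_le (min_le_right _ _)
  have hdiv' : ¬ Summable fun n => ν.real (Metric.closedBall p (min (r n) (s n))) := by
    simp only [hmin]
    exact not_summable_min_one_div (fun _ _ hab => hmono (hr hab)) (fun _ => measureReal_nonneg)
      hdiv
  have key : ∀ᵐ x ∂ν, ∃ᶠ n in atTop, f^[n] x ∈ Metric.closedBall p (min (r n) (s n)) := by
    rcases hmix with ⟨Θ, θ, hΘ, hθ, hθ1, hO, hno⟩ | ⟨Θ, ζ, hΘ, hζ, hO, hno⟩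
    · exact ae_frequently_mem_closedBall_of_log hf hδ h hann hpos hΘ hr' hr0' hm' hdiv'
        hθ hθ1 hO hno
    · exact ae_frequently_mem_closedBall_of_poly hf hδ h hann hpos hΘ hr' hr0' hm' hdiv'
        hζ hO hno
  filter_upwards [key] with x hx
  exact hx.mono fun n hn => Metric.closedBall_subset_closedBall (min_le_left _ _) hn

theorem ae_eventually_notMem_closedBall (hf : MeasurePreserving f ν ν)
    (hsum : Summable fun n => ν.real (Metric.closedBall p (r n))) :
    ∀ᵐ x ∂ν, ∀ᶠ n in atTop, f^[n] x ∉ Metric.closedBall p (r n) := by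
  refine ae_eventually_notMem (s := fun n => f^[n] ⁻¹' Metric.closedBall p (r n)) ?_
  have : ∀ n, ν (f^[n] ⁻¹' Metric.closedBall p (r n)) =
      ENNReal.ofReal (ν.real (Metric.closedBall p (r n))) := fun n => by
    rw [(hf.iterate n).measure_preimage
      Metric.isClosed_closedBall.measurableSet.nullMeasurableSet, ofReal_measureReal]
  simp only [this]
  exact hsum.tsum_ofReal_ne_top

omit [BorelSpace X] in
-- Iterate doubling until `2 ^ k` exceeds `t`; `r → 0` puts the radii in its range. Applied to
-- contracted radii, it also transfers divergence.
theorem DoublingAt.summable_mul (hdbl : DoublingAt ν p) (hr0 : ∀ n, 0 < r n)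
    (hlim : Tendsto r atTop (𝓝 0))
    (hsum : Summable fun n => ν.real (Metric.closedBall p (r n))) (t : ℝ) :
    Summable fun n => ν.real (Metric.closedBall p (t * r n)) := by
  obtain ⟨C, r₁, hr₁, hC⟩ := hdbl
  have hpow : ∀ k : ℕ, Summable fun n => ν.real (Metric.closedBall p (2 ^ k * r n)) := by
    intro k
    induction k with
    | zero => simpa using hsum
    | succ k ih =>
      refine Summable.of_norm_bounded_eventually_nat (ih.mul_left C) ?_
      have h1 : Tendsto (fun n => 2 ^ k * r n) atTop (𝓝 0) := by
        simpa using hlim.const_mul (2 ^ k)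
      filter_upwards [h1.eventually (gt_mem_nhds hr₁)] with n hn
      rw [Real.norm_eq_abs, abs_of_nonneg measureReal_nonneg, pow_succ', mul_assoc]
      have := hr0 n
      exact hC _ (by positivity) hn
  obtain ⟨k, hk⟩ := pow_unbounded_of_one_lt t one_lt_two
  refine Summable.of_nonneg_of_le (fun _ => measureReal_nonneg) (fun n => ?_) (hpow k)
  exact measureReal_closedBall_mono ν p (mul_le_mul_of_nonneg_right hk.le (hr0 n).le)

end DynamicalBorelCantelli

/-! ### Maximum process and its limsup -/

section MaxProcess

variable {X : Type*} {f : X → X} {φ : X → ℝ} {x : X}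

theorem le_maxProcess {i n : ℕ} (hi : i < n) : φ (f^[i] x) ≤ maxProcess f φ n x :=
  le_ciSup (f := fun i : Fin n => φ (f^[(i : ℕ)] x)) (Set.finite_range _).bddAbove ⟨i, hi⟩

theorem maxProcess_nonneg (hφ : ∀ y, 0 ≤ φ y) (n : ℕ) : 0 ≤ maxProcess f φ n x :=
  Real.iSup_nonneg fun _ => hφ _

/-- Early terms are absorbed by `v → ∞`; a later index `i < n` has `i + 1 ≤ n`, hence `v (i + 1) ≤ v
n`. -/
theorem eventually_maxProcess_le {v : ℕ → ℝ} (hv : Monotone v) (hv' : Tendsto v atTop atTop)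
    {c : ℝ} (hc : 0 < c) (h : ∀ᶠ n in atTop, φ (f^[n] x) ≤ c * v (n + 1)) :
    ∀ᶠ n in atTop, maxProcess f φ n x ≤ c * v n := by
  obtain ⟨n₀, hn₀⟩ := eventually_atTop.1 h
  filter_upwards [hv'.eventually_ge_atTop ((∑ i ∈ Finset.range n₀, |φ (f^[i] x)|) / c),
    hv'.eventually_ge_atTop 0] with n hn hn0
  rw [div_le_iff₀' hc] at hn
  refine Real.iSup_le (fun i => ?_) (by positivity)
  rcases lt_or_ge (i : ℕ) n₀ with hi | hi
  · refine le_trans ?_ hn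
    exact (le_abs_self _).trans (Finset.single_le_sum (f := fun i => |φ (f^[i] x)|)
      (fun _ _ => abs_nonneg _) (Finset.mem_range.2 hi))
  · refine (hn₀ i hi).trans ?_
    gcongr
    exact hv i.2

theorem limsup_coe_eq_zero {G : ℕ → ℝ} (h0 : ∀ᶠ n in atTop, 0 ≤ G n)
    (h : ∀ ε : ℝ, 0 < ε → ∀ᶠ n in atTop, G n ≤ ε) :
    limsup (fun n => (G n : EReal)) atTop = 0 := by
  have hG : Tendsto G atTop (𝓝 0) := by
    rw [Metric.tendsto_atTop']
    intro ε hε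
    obtain ⟨N, hN⟩ := eventually_atTop.1 (h0.and (h (ε / 2) (by positivity)))
    refine ⟨N, fun n hn => ?_⟩
    have := hN n hn.le
    rw [Real.dist_eq, sub_zero, abs_of_nonneg this.1]
    linarith [this.2]
  exact ((continuous_coe_real_ereal.tendsto 0).comp hG).limsup_eq

theorem limsup_coe_eq_top {G : ℕ → ℝ} (h : ∀ K : ℝ, ∃ᶠ n in atTop, K ≤ G n) :
    limsup (fun n => (G n : EReal)) atTop = ⊤ := by
  rw [EReal.eq_top_iff_forall_lt]
  intro y
  have h1 : ((y + 1 : ℝ) : EReal) ≤ limsup (fun n => (G n : EReal)) atTop :=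
    le_limsup_of_frequently_le ((h (y + 1)).mono fun n hn => EReal.coe_le_coe_iff.2 hn)
  exact lt_of_lt_of_le (EReal.coe_lt_coe_iff.2 (by linarith)) h1

end MaxProcess

/-! ### Zero–infinity dichotomy -/

theorem measure_sphere_eq_zero_of_map_absolutelyContinuous {d : ℕ} (hd : 0 < d)
    {X : Set (EuclideanSpace ℝ (Fin d))} {ν : Measure X}
    (hac : ν.map (Subtype.val : X → EuclideanSpace ℝ (Fin d)) ≪ volume) (p : X) (t : ℝ) :
    ν (Metric.sphere p t) = 0 := by
  have : Nonempty (Fin d) := ⟨⟨0, hd⟩⟩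
  have h1 := hac (Measure.addHaar_sphere volume (p : EuclideanSpace ℝ (Fin d)) t)
  rw [Measure.map_apply measurable_subtype_coe Metric.isClosed_sphere.measurableSet] at h1
  exact h1

theorem mul_rpow_neg_inv_rpow_neg {α t v : ℝ} (hα : 0 < α) (ht : 0 < t) (hv : 0 < v) :
    (t * v ^ (-α⁻¹)) ^ (-α) = t ^ (-α) * v := by
  rw [Real.mul_rpow ht.le (by positivity), ← Real.rpow_mul hv.le]
  simp [hα.ne']

theorem corollary4p4 {d : ℕ} (hd : 0 < d) (X : Set (EuclideanSpace ℝ (Fin d)))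
    (f : X → X) (ν : Measure X) [IsProbabilityMeasure ν] (hf : Ergodic f ν)
    (hac : ν.map (Subtype.val : X → EuclideanSpace ℝ (Fin d)) ≪ volume)
    (p : X) (D : ℝ) (hD : HasLocalDim ν p D)
    (δ : ℝ) (hδ : 0 < δ) (hann : AnnulusRegular ν p δ)
    (hdbl : DoublingAt ν p)
    (hmix :
      (∃ (Θ : ℕ → ℝ) (θ : ℝ), LipDecay f ν Θ ∧ 0 < θ ∧ θ < 1 ∧
        (Θ =O[atTop] fun n : ℕ => θ ^ n) ∧ NoShortReturnsLog f ν p) ∨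
      (∃ (Θ : ℕ → ℝ) (ζ : ℝ), LipDecay f ν Θ ∧ 1 < ζ ∧
        (Θ =O[atTop] fun n : ℕ => (n : ℝ) ^ (-ζ)) ∧
        NoShortReturnsPoly f ν p ((2 * δ⁻¹ + 1) / (ζ - 1))))
    (α : ℝ) (hα : 0 < α) (u : ℕ → ℝ) (hu : Monotone u) (hu' : Tendsto u atTop atTop) :
    (∀ᵐ x ∂ν, limsup (fun n : ℕ =>
        ((maxProcess f (fun y => dist y p ^ (-α)) n x / u n : ℝ) : EReal)) atTop = 0) ∨
      (∀ᵐ x ∂ν, limsup (fun n : ℕ =>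
        ((maxProcess f (fun y => dist y p ^ (-α)) n x / u n : ℝ) : EReal)) atTop = ⊤) := by
  have hmp := hf.toMeasurePreserving
  have hsph := measure_sphere_eq_zero_of_map_absolutelyContinuous hd hac p
  set φ : X → ℝ := fun y => dist y p ^ (-α) with hφ
  have hφ0 : ∀ y, 0 ≤ φ y := fun y => Real.rpow_nonneg dist_nonneg _
  -- Keeps the levels positive without changing large indices.
  set v : ℕ → ℝ := fun n => max (u n) 1 with hv
  have hv1 : ∀ n, 1 ≤ v n := fun n => le_max_right _ _
  have hv0 : ∀ n, 0 < v n := fun n => one_pos.trans_le (hv1 n)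
  have hvmono : Monotone v := fun _ _ hab => max_le_max (hu hab) le_rfl
  have hvtop : Tendsto v atTop atTop := tendsto_atTop_mono (fun n => le_max_left _ _) hu'
  have huv : ∀ᶠ n in atTop, v n = u n := by
    filter_upwards [hu'.eventually_ge_atTop 1] with n hn using max_eq_left hn
  -- The shift is due to `f^[n] x` first entering the maximum at time `n + 1`.
  set ρ : ℕ → ℝ := fun n => v (n + 1) ^ (-α⁻¹) with hρ
  have hρ0 : ∀ n, 0 < ρ n := fun n => Real.rpow_pos_of_pos (hv0 _) _
  have hρanti : Antitone ρ := fun a b hab =>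
    Real.rpow_le_rpow_of_nonpos (hv0 _) (hvmono (by omega)) (by simpa using hα.le)
  have hρlim : Tendsto ρ atTop (𝓝 0) :=
    (tendsto_rpow_neg_atTop (inv_pos.2 hα)).comp (hvtop.comp (tendsto_add_atTop_nat 1))
  by_cases hsum : Summable fun n => ν.real (Metric.closedBall p (ρ n))
  · left
    have hae : ∀ᵐ x ∂ν, ∀ k : ℕ, ∀ᶠ n in atTop,
        f^[n] x ∉ Metric.closedBall p (((k : ℝ) + 1) * ρ n) :=
      ae_all_iff.2 fun k => ae_eventually_notMem_closedBall hmp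
        (hdbl.summable_mul hρ0 hρlim hsum _)
    filter_upwards [hae] with x hx
    refine limsup_coe_eq_zero ?_ fun ε hε => ?_
    · filter_upwards [huv] with n hn
      exact div_nonneg (maxProcess_nonneg hφ0 n) (hn ▸ (hv0 n).le)
    have hk : Tendsto (fun k : ℕ => ((k : ℝ) + 1) ^ (-α)) atTop (𝓝 0) :=
      (tendsto_rpow_neg_atTop hα).comp
        (tendsto_atTop_add_const_right _ _ tendsto_natCast_atTop_atTop)
    obtain ⟨k, hk⟩ := (hk.eventually (gt_mem_nhds hε)).exists
    have hk0 : (0 : ℝ) < (k : ℝ) + 1 := by positivity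
    have hM := eventually_maxProcess_le (f := f) (φ := φ) (x := x) hvmono hvtop
      (Real.rpow_pos_of_pos hk0 (-α)) ((hx k).mono fun n hn => by
        rw [Metric.mem_closedBall, not_le] at hn
        rw [← mul_rpow_neg_inv_rpow_neg hα hk0 (hv0 _)]
        exact Real.rpow_le_rpow_of_nonpos (mul_pos hk0 (hρ0 n)) hn.le (by simpa using hα.le))
    filter_upwards [hM, huv] with n hn hn'
    rw [← hn', div_le_iff₀ (hv0 n)]
    exact hn.trans (mul_le_mul_of_nonneg_right hk.le (hv0 n).le)
  · right
    have hae : ∀ᵐ x ∂ν, ∀ k : ℕ, ∃ᶠ n in atTop,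
        f^[n] x ∈ Metric.closedBall p (((k : ℝ) + 1)⁻¹ * ρ n) := by
      refine ae_all_iff.2 fun k => ?_
      have hk0 : (0 : ℝ) < ((k : ℝ) + 1)⁻¹ := by positivity
      refine ae_frequently_mem_closedBall_of_mixing hmp hδ hsph hann hD.1 hmix
        (hρanti.const_mul hk0.le) (fun n => mul_pos hk0 (hρ0 n)) fun hs => hsum ?_
      have hlim : Tendsto (fun n => ((k : ℝ) + 1)⁻¹ * ρ n) atTop (𝓝 0) := by
        simpa using hρlim.const_mul ((k : ℝ) + 1)⁻¹
      have := hdbl.summable_mul (fun n => mul_pos hk0 (hρ0 n)) hlim hs ((k : ℝ) + 1)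
      simpa only [mul_inv_cancel_left₀ (inv_pos.1 hk0).ne'] using this
    -- By convention `0 ^ (-α) = 0`, so landing exactly on `p` would not make `φ` large; this has
    -- probability zero.
    have hne : ∀ᵐ x ∂ν, ∀ n : ℕ, f^[n] x ≠ p := by
      refine ae_all_iff.2 fun n => ?_
      have hp : ν {p} = 0 := by simpa using hsph 0
      exact measure_eq_zero_iff_ae_notMem.1
        (((hmp.iterate n).measure_preimage (measurableSet_singleton p).nullMeasurableSet).trans hp)
    filter_upwards [hae, hne] with x hx hxp
    refine limsup_coe_eq_top fun K => ?_
    have hk : Tendsto (fun k : ℕ => ((k : ℝ) + 1) ^ α) atTop atTop :=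
      (tendsto_rpow_atTop hα).comp
        (tendsto_atTop_add_const_right _ _ tendsto_natCast_atTop_atTop)
    obtain ⟨k, hk⟩ := (hk.eventually_ge_atTop K).exists
    have hk0 : (0 : ℝ) < ((k : ℝ) + 1)⁻¹ := by positivity
    refine (tendsto_add_atTop_nat 1).frequently (((hx k).and_eventually
      ((tendsto_add_atTop_nat 1).eventually huv)).mono fun n hn => ?_)
    rw [← hn.2, le_div_iff₀ (hv0 _)]
    calc K * v (n + 1) ≤ ((k : ℝ) + 1) ^ α * v (n + 1) :=
          mul_le_mul_of_nonneg_right hk (hv0 _).le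
      _ = (((k : ℝ) + 1)⁻¹ * ρ n) ^ (-α) := by
          rw [mul_rpow_neg_inv_rpow_neg hα hk0 (hv0 _), Real.inv_rpow (by positivity),
            Real.rpow_neg (by positivity), inv_inv]
      _ ≤ φ (f^[n] x) :=
          Real.rpow_le_rpow_of_nonpos (dist_pos.2 (hxp n)) hn.1 (by simpa using hα.le)
      _ ≤ _ := le_maxProcess n.lt_succ_self
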